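/- Let $a\ge 1$, let $p=(p_1,\dots,p_a)$ be a probability vector with every $p_i>0$, and let $n\ge 1$, $k\ge 0$ be integers. The $p$-biased recursive tree ($p$-BRT) with $n$ nodes is the following random rooted tree on $\{1,\dots,n\}$. Cut the deck $2,3,\dots,n$ into $a$ consecutive piles whose sizes $(b_1,\dots,b_a)$ are multinomially distributed, $\mathbb P(b_1,\dots,b_a)=\binom{n-1}{b_1,\dots,b_a}\prod_{i=1}^a p_i^{b_i}$, and then choose uniformly at random one of the interleavings of the piles in which the cards of each pile keep their original order. Let $\gamma=\gamma_1\cdots\gamma_{n-1}$ be the resulting arrangement of $\{2,\dots,n\}$. Node $1$ is the root, and the parent of a node $i\ge 2$ is the rightmost element of $\gamma$ that precedes $i$ and is smaller than $i$, or the root $1$ if there is no such element. The descendants of a node are its children and, recursively, their descendants. Let $Y_{\ge k,n}^p$ be the number of nodes with at least $k$ descendants in the $p$-BRT with $n$ nodes, and let $\sigma_n^2=\mathrm{Var}(Y_{\ge k,n}^p)$, $\sigma_n\ge 0$. If $\sigma_n>0$, put $W_n=(Y_{\ge k,n}^p-\mathbb E[Y_{\ge k,n}^p])/\sigma_n$.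 Then $$d_W(W_n,\mathcal G)\;\le\;\frac{2k+1}{\sigma_n}\left((2k+1)+\frac{\sqrt{28}\,(2k+1)^{1/2}}{\sqrt{\pi}}\right),$$ where $\mathcal G$ is a standard normal random variable and $d_W(X,Z)=\sup\{|\mathbb E h(X)-\mathbb E h(Z)| : h:\mathbb R\to\mathbb R \text{ is } 1\text{-Lipschitz}\}$ is the Wasserstein distance. Moreover, if $a\ge 2$ and $k\ge 1$ are fixed (and $p$ is fixed), then $\sigma_n^2$ is of exact order $n$ as $n\to\infty$, that is, $c\,n\le\sigma_n^2\le C\,n$ for some constants $0<c\le C$ and all large $n$, and consequently the right-hand side of the bound above is $O(n^{-1/2})$. -/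

import Mathlib

open MeasureTheory ProbabilityTheory Filter Asymptotics
open scoped ENNReal

namespace BRT

/-- Permutations of a deck of `m` cards form a finite set; every subset of it is an event. -/
instance permMeasurableSpace (m : ℕ) : MeasurableSpace (Equiv.Perm (Fin m)) := ⊤

noncomputable section

/-! ### Biased riffle shuffles

A deck of `m` cards is `Fin m`, in the original order `0, 1, …, m - 1`. A permutation `γ` is read as
an arrangement of the deck: `γ s` is the card at position `s`, and `γ.symm c` is the position of
card `c`. -/

/-- The sizes `(b_1, …, b_a)` of the piles have the multinomial distribution: `b` with
`∑ i, b i = m` has probability `m! / (b_1! ⋯ b_a!) * ∏ i, (p i) ^ (b i)`. -/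
def pileSizes {a : ℕ} (p : PMF (Fin a)) (m : ℕ) : PMF (Fin a → ℕ) :=
  PMF.ofFinset
    (fun b => if ∑ i, b i = m then
      (Nat.multinomial Finset.univ b : ℝ≥0∞) * ∏ i, p i ^ b i else 0)
    (Finset.piAntidiag Finset.univ m)
    (by
      have h1 : ∑ i, p i = 1 := by
        rw [← tsum_fintype (L := .unconditional _), p.tsum_coe]
      have h2 := Finset.sum_pow_eq_sum_piAntidiag (Finset.univ : Finset (Fin a)) (fun i => p i) m
      rw [h1, one_pow] at h2
      rw [h2]
      refine Finset.sum_congr rfl fun b hb => ?_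
      rw [if_pos (Finset.mem_piAntidiag.1 hb).1])
    (by
      intro b hb
      refine if_neg fun h => hb ?_
      simp [Finset.mem_piAntidiag, h])

/-- When the deck is cut into consecutive piles of sizes `b`, card `c` lies in pile `i`. -/
def InPile {a m : ℕ} (b : Fin a → ℕ) (i : Fin a) (c : Fin m) : Prop :=
  ∑ j ∈ Finset.Iio i, b j ≤ (c : ℕ) ∧ (c : ℕ) < ∑ j ∈ Finset.Iic i, b j

open scoped Classical in
/-- The arrangements that arise by interleaving piles of sizes `b`: those in which the cards of each
pile stay in their original order. -/
def interleavings {a : ℕ} (m : ℕ) (b : Fin a → ℕ) : Finset (Equiv.Perm (Fin m)) :=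
  Finset.univ.filter fun γ =>
    ∀ (i : Fin a) (c d : Fin m), InPile b i c → InPile b i d → c < d → γ.symm c < γ.symm d

theorem interleavings_nonempty {a : ℕ} (m : ℕ) (b : Fin a → ℕ) : (interleavings m b).Nonempty :=
  ⟨1, by simp only [interleavings, Finset.mem_filter, Finset.mem_univ, true_and]
         exact fun _ _ _ _ _ h => h⟩

/-- The `p`-biased riffle shuffle of `m` cards: choose multinomial pile sizes, then one of the
interleavings of the piles uniformly at random. -/
def riffle {a : ℕ} (p : PMF (Fin a)) (m : ℕ) : PMF (Equiv.Perm (Fin m)) :=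
  (pileSizes p m).bind fun b =>
    PMF.uniformOfFinset (interleavings m b) (interleavings_nonempty m b)

/-! ### The recursive tree of a permutation

The tree has vertex set `Fin (m + 1)`. Vertex `0` is the root (the node called `1` when the nodes are
`1, …, m + 1`), and card `c` is the vertex `c.succ` (the node called `c + 2`). -/

/-- The positions to the left of card `c` that hold a smaller card. -/
def smallerLeft {m : ℕ} (γ : Equiv.Perm (Fin m)) (c : Fin m) : Finset (Fin m) :=
  Finset.univ.filter fun s => s < γ.symm c ∧ γ s < c

/-- The parent of card `c`: the rightmost card which precedes `c` and is smaller than `c`, and the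
root if there is no such card. -/
def parent {m : ℕ} (γ : Equiv.Perm (Fin m)) (c : Fin m) : Fin (m + 1) :=
  if h : (smallerLeft γ c).Nonempty then (γ ((smallerLeft γ c).max' h)).succ else 0

/-- `w` is a child of `v` in the tree of `γ`. -/
def IsChild {m : ℕ} (γ : Equiv.Perm (Fin m)) (v w : Fin (m + 1)) : Prop :=
  ∃ c : Fin m, w = c.succ ∧ v = parent γ c

/-- The descendants of `v`: its children, their children, and so on. -/
def descendants {m : ℕ} (γ : Equiv.Perm (Fin m)) (v : Fin (m + 1)) : Set (Fin (m + 1)) :=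
  {w | Relation.TransGen (IsChild γ) v w}

/-- The number of nodes of the tree of `γ` with at least `k` descendants. -/
def numAtLeast {m : ℕ} (k : ℕ) (γ : Equiv.Perm (Fin m)) : ℕ :=
  {v : Fin (m + 1) | k ≤ (descendants γ v).ncard}.ncard

/-! ### The `p`-biased recursive tree with `n` nodes -/

/-- The law of the permutation of `n - 1` cards from which the `p`-biased recursive tree with `n`
nodes, `1 ≤ n`, is built. -/
def treeLaw {a : ℕ} (p : PMF (Fin a)) (n : ℕ) : Measure (Equiv.Perm (Fin (n - 1))) :=
  (riffle p (n - 1)).toMeasure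

/-- The variance of the number of nodes with at least `k` descendants. -/
def varAtLeast {a : ℕ} (p : PMF (Fin a)) (k n : ℕ) : ℝ :=
  variance (fun γ => (numAtLeast k γ : ℝ)) (treeLaw p n)

/-- The standard deviation of the number of nodes with at least `k` descendants. -/
def sdAtLeast {a : ℕ} (p : PMF (Fin a)) (k n : ℕ) : ℝ :=
  Real.sqrt (varAtLeast p k n)

/-- The normalized number of nodes with at least `k` descendants. -/
def normalized {a : ℕ} (p : PMF (Fin a)) (k n : ℕ) (γ : Equiv.Perm (Fin (n - 1))) : ℝ :=
  ((numAtLeast k γ : ℝ) - ∫ γ', (numAtLeast k γ' : ℝ) ∂(treeLaw p n)) / sdAtLeast p k n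

/-! ### Wasserstein distance -/

/-- The (first) Wasserstein distance of two probability measures on `ℝ` with finite first moments:
the supremum of `|∫ h dμ - ∫ h dν|` over all `1`-Lipschitz functions `h`. -/
def wassersteinDist (μ ν : Measure ℝ) : ℝ≥0∞ :=
  ⨆ (h : ℝ → ℝ) (_ : LipschitzWith 1 h), ENNReal.ofReal |(∫ x, h x ∂μ) - ∫ x, h x ∂ν|

/-- The bound `(2k+1)/σ * ((2k+1) + √28 (2k+1)^(1/2) / √π)`. -/
def cltBound (k : ℕ) (σ : ℝ) : ℝ :=
  (2 * (k : ℝ) + 1) / σ *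
    ((2 * (k : ℝ) + 1) + Real.sqrt 28 * Real.sqrt (2 * (k : ℝ) + 1) / Real.sqrt Real.pi)

end

end BRT

/-!
A biased riffle shuffle is the ranking of a random word: give the positions of the deck independent
letters with distribution `p`, and order the positions by letter, equal letters from left to right
(`treeLaw_eq_map`). In the tree of the ranking, the descendants of the node at position `s` sit at
the positions directly after `s` up to the first strictly smaller letter
(`le_ncard_descendants_succ_iff`). So, apart from the root, the number of nodes with at least `k`
descendants is a sum of indicators `minInd k s`, each a function of the letters in a window of
length `k + 1` (`numAtLeast_ranks`). These indicators form a stationary `k`-dependent sequence.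

Normal approximation of such a sum is Stein's method (`KDependent.abs_integral_sub_le`). The
solution of Stein's equation for a `1`-Lipschitz function has a derivative that is bounded by `3 / 2`
and `2`-Lipschitz (`exists_stein_solution`); both follow from Mills' inequalities, with no regularity
of the test function beyond its Lipschitz bound.

This gives an error in terms of the variance of the sum over a window of length `2 * k + 1`, and that
has to be compared with the total variance although the covariances can be negative. With
`γ j = windowCov p k j` and `v = asympVar p k = γ 0 + 2 * ∑ γ j`, a sum over a block of length
`b ≥ k` has variance `b * v - 2 * ∑ j * γ j`. The two facts needed are `γ 0 ≤ (2 * k + 1) * v`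
(`windowCov_zero_le`) and `-∑ j * γ j ≤ 3 / 8 * k * γ 0` (`neg_covMoment_le`). Both are instances of
one inequality, `weighted_cov_ge`, which bounds weighted sums of the `γ j` from below by a multiple
of `γ 0`. Its proof builds the distribution `p` by adding one letter at a time below the others. Each
addition rescales the old distribution by `s` and leaves a quadratic polynomial in `s ^ k * m`, with
`m` the old mean of the indicators, whose discriminant is not positive. Since the rescaling damps the
`j`-th term by `s ^ j`, the inequality is carried along for all geometrically damped weights at
once.

If the deck is so short that the comparison fails, the right-hand side of the bound is at least `2`,
which bounds the distance of any standardized variable from the normal law. The first of the two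
facts also gives `v > 0` as soon as the indicator is not constant, hence the order of the variance.
-/

namespace BRT

/-! ### The riffle shuffle as the ranking of a random word -/

/-- `γ` ranks the positions of the word `w`: positions are ordered by their letters, and positions
that carry the same letter from left to right. -/
def Ranks {a m : ℕ} (γ : Equiv.Perm (Fin m)) (w : Fin m → Fin a) : Prop :=
  ∀ s t, s < t → (γ s < γ t ↔ w s ≤ w t)

/-- The ranking of the positions of a word: `ranking w s` is the number of positions that precede
`s` in the lexicographic order by letter and position. -/
def ranking {a m : ℕ} (w : Fin m → Fin a) : Equiv.Perm (Fin m) := (Tuple.sort w)⁻¹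

/-- The number of occurrences of each letter in a word. -/
def letterCount {a m : ℕ} (w : Fin m → Fin a) (i : Fin a) : ℕ :=
  (Finset.univ.filter fun s => w s = i).card

theorem ranks_ranking {a m : ℕ} (w : Fin m → Fin a) : Ranks (ranking w) w := by
  intro s t hst
  obtain ⟨hmono, hstab⟩ := (Tuple.eq_sort_iff (f := w) (σ := Tuple.sort w)).1 rfl
  set σ := Tuple.sort w
  have hs : σ (σ⁻¹ s) = s := σ.apply_symm_apply s
  have ht : σ (σ⁻¹ t) = t := σ.apply_symm_apply t
  constructor
  · intro h
    have h2 : w (σ (σ⁻¹ s)) ≤ w (σ (σ⁻¹ t)) := hmono h.le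
    rwa [hs, ht] at h2
  · intro h
    by_contra hlt
    rcases (not_lt.1 hlt).lt_or_eq with hlt | heq
    · have h2 : w (σ (σ⁻¹ t)) ≤ w (σ (σ⁻¹ s)) := hmono hlt.le
      rw [hs, ht] at h2
      have h3 := hstab _ _ hlt (by rw [show σ ((ranking w) t) = t from ht,
        show σ ((ranking w) s) = s from hs]; exact le_antisymm h2 h)
      rw [show σ ((ranking w) t) = t from ht, show σ ((ranking w) s) = s from hs] at h3
      exact absurd hst h3.asymm
    · exact hst.ne ((ranking w).injective heq).symm

theorem Ranks.lt_iff {a m : ℕ} {γ : Equiv.Perm (Fin m)} {w : Fin m → Fin a} (h : Ranks γ w)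
    (s t : Fin m) : γ s < γ t ↔ w s < w t ∨ (w s = w t ∧ s < t) := by
  rcases lt_trichotomy s t with hst | rfl | hst
  · rw [h s t hst, le_iff_lt_or_eq]; simp [hst]
  · simp
  · have h1 := h t s hst
    have h2 : γ s < γ t ↔ ¬ γ t < γ s := by
      rw [not_lt]
      exact ⟨le_of_lt, fun h => lt_of_le_of_ne h fun e => hst.ne (γ.injective e).symm⟩
    rw [h2, h1, not_le]
    simp [hst.asymm]

theorem card_filter_perm_lt {m : ℕ} (γ : Equiv.Perm (Fin m)) (c : ℕ) (hc : c ≤ m) :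
    (Finset.univ.filter fun t => (γ t : ℕ) < c).card = c := by
  have h1 : (Finset.univ.filter fun t => (γ t : ℕ) < c).map γ.toEmbedding
      = Finset.univ.filter fun d : Fin m => (d : ℕ) < c := by
    ext d
    simp only [Finset.mem_map, Finset.mem_filter, Finset.mem_univ, true_and]
    exact ⟨by rintro ⟨t, ht, rfl⟩; exact ht, fun h => ⟨γ.symm d, by simpa using h, by simp⟩⟩
  rw [← Finset.card_map γ.toEmbedding, h1, Fin.card_filter_val_lt]
  exact min_eq_right hc

theorem Ranks.perm_unique {a m : ℕ} {γ γ' : Equiv.Perm (Fin m)} {w : Fin m → Fin a}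
    (h : Ranks γ w) (h' : Ranks γ' w) : γ = γ' := by
  ext s
  rw [← card_filter_perm_lt γ (γ s) (γ s).2.le, ← card_filter_perm_lt γ' (γ' s) (γ' s).2.le]
  congr 1
  ext t
  have : (γ t : ℕ) < γ s ↔ (γ' t : ℕ) < γ' s := by
    rw [← Fin.lt_def, ← Fin.lt_def, h.lt_iff, h'.lt_iff]
  simp only [Finset.mem_filter, Finset.mem_univ, true_and, this]

theorem sum_letterCount {a m : ℕ} (w : Fin m → Fin a) (S : Finset (Fin a)) :
    ∑ i ∈ S, letterCount w i = (Finset.univ.filter fun s => w s ∈ S).card := by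
  rw [Finset.card_eq_sum_card_fiberwise (f := w) (t := S)]
  · refine Finset.sum_congr rfl fun i hi => ?_
    rw [letterCount, Finset.filter_filter]
    congr 1
    ext s
    simp only [Finset.mem_filter, Finset.mem_univ, true_and]
    exact ⟨fun h => ⟨h ▸ hi, h⟩, fun h => h.2⟩
  · intro s hs
    simpa using hs

theorem sum_letterCount_univ {a m : ℕ} (w : Fin m → Fin a) : ∑ i, letterCount w i = m := by
  simp [sum_letterCount]

theorem InPile.unique {a m : ℕ} {b : Fin a → ℕ} {i j : Fin a} {c : Fin m} (hi : InPile b i c)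
    (hj : InPile b j c) : i = j := by
  have key : ∀ i j : Fin a, InPile b i c → InPile b j c → ¬ i < j := by
    intro i j hi hj hij
    have : ∑ l ∈ Finset.Iic i, b l ≤ ∑ l ∈ Finset.Iio j, b l := by
      refine Finset.sum_le_sum_of_subset fun l hl => ?_
      simp only [Finset.mem_Iic, Finset.mem_Iio] at *
      exact hl.trans_lt hij
    exact absurd hi.2 (not_lt.2 (this.trans hj.1))
  exact le_antisymm (not_lt.1 (key _ _ hj hi)) (not_lt.1 (key _ _ hi hj))

/-- Piles lie in the deck one after the other. -/
theorem InPile.lt_of_lt {a m : ℕ} {b : Fin a → ℕ} {i j : Fin a} {c d : Fin m} (hi : InPile b i c)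
    (hj : InPile b j d) (hij : i < j) : c < d := by
  have : ∑ l ∈ Finset.Iic i, b l ≤ ∑ l ∈ Finset.Iio j, b l := by
    refine Finset.sum_le_sum_of_subset fun l hl => ?_
    simp only [Finset.mem_Iic, Finset.mem_Iio] at *
    exact hl.trans_lt hij
  exact Fin.lt_def.2 (hi.2.trans_le (this.trans hj.1))

theorem exists_inPile {a m : ℕ} {b : Fin a → ℕ} (hb : ∑ i, b i = m) (c : Fin m) :
    ∃ i, InPile b i c := by
  classical
  -- The pile of `c` is the first one at whose end more than `c` cards have been used.
  have hne : (Finset.univ.filter fun i => (c : ℕ) < ∑ j ∈ Finset.Iic i, b j).Nonempty := by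
    have ha : 0 < a := by
      rcases Nat.eq_zero_or_pos a with rfl | h
      · have := c.2; simp at hb; omega
      · exact h
    refine ⟨⟨a - 1, by omega⟩, ?_⟩
    have : Finset.Iic (⟨a - 1, by omega⟩ : Fin a) = Finset.univ := by
      ext j; simp [Fin.le_def]; omega
    simp [this, hb]
  refine ⟨_, ?_, (Finset.mem_filter.1 (Finset.min'_mem _ hne)).2⟩
  set i := Finset.min' _ hne
  by_contra hlt
  have hlt := not_le.1 hlt
  by_cases hi : (i : ℕ) = 0
  · have : Finset.Iio i = ∅ := by ext j; simp [Fin.lt_def, hi]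
    simp [this] at hlt
  · have hmem : (⟨i - 1, by omega⟩ : Fin a) ∈
        Finset.univ.filter fun i => (c : ℕ) < ∑ j ∈ Finset.Iic i, b j := by
      have : Finset.Iic (⟨i - 1, by omega⟩ : Fin a) = Finset.Iio i := by
        ext j; rw [Finset.mem_Iic, Finset.mem_Iio, Fin.le_def, Fin.lt_def]; simp only; omega
      simp [this, hlt]
    have := Finset.min'_le _ _ hmem
    have h2 : i ≤ (⟨i - 1, by omega⟩ : Fin a) := this
    rw [Fin.le_def] at h2
    simp only at h2
    omega

/-- In the ranking of a word, the positions with letter `i` receive the cards of pile `i`. -/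
theorem Ranks.inPile {a m : ℕ} {γ : Equiv.Perm (Fin m)} {w : Fin m → Fin a} (h : Ranks γ w)
    (s : Fin m) : InPile (letterCount w) (w s) (γ s) := by
  constructor
  · rw [sum_letterCount, ← card_filter_perm_lt γ (γ s) (γ s).2.le]
    refine Finset.card_le_card fun t ht => ?_
    simp only [Finset.mem_filter, Finset.mem_univ, true_and, Finset.mem_Iio] at *
    exact (h.lt_iff t s).2 (Or.inl ht)
  · rw [sum_letterCount]
    refine lt_of_lt_of_le (Nat.lt_succ_self (γ s)) ?_
    rw [← card_filter_perm_lt γ (γ s).val.succ (γ s).2]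
    refine Finset.card_le_card fun t ht => ?_
    simp only [Finset.mem_filter, Finset.mem_univ, true_and, Finset.mem_Iic] at *
    rcases (Nat.lt_succ_iff.1 ht).lt_or_eq with hlt | heq
    · rcases (h.lt_iff t s).1 hlt with h1 | h1
      · exact h1.le
      · exact h1.1.le
    · rw [γ.injective (Fin.ext heq)]

theorem Ranks.inPile_iff {a m : ℕ} {γ : Equiv.Perm (Fin m)} {w : Fin m → Fin a} (h : Ranks γ w)
    (s : Fin m) (i : Fin a) : InPile (letterCount w) i (γ s) ↔ w s = i :=
  ⟨fun hi => (h.inPile s).unique hi, fun hi => hi ▸ h.inPile s⟩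

theorem Ranks.mem_interleavings {a m : ℕ} {γ : Equiv.Perm (Fin m)} {w : Fin m → Fin a}
    (h : Ranks γ w) : γ ∈ interleavings m (letterCount w) := by
  simp only [interleavings, Finset.mem_filter, Finset.mem_univ, true_and]
  intro i c d hc hd hcd
  rw [← γ.apply_symm_apply c] at hc hcd
  rw [← γ.apply_symm_apply d] at hd hcd
  rw [h.inPile_iff] at hc hd
  rcases (h.lt_iff _ _).1 hcd with h1 | h1
  · exact absurd h1 (by rw [hc, hd]; exact lt_irrefl i)
  · exact h1.2

theorem exists_ranks_of_mem_interleavings {a m : ℕ} {b : Fin a → ℕ} (hb : ∑ i, b i = m)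
    {γ : Equiv.Perm (Fin m)} (hγ : γ ∈ interleavings m b) :
    ∃ w : Fin m → Fin a, letterCount w = b ∧ Ranks γ w := by
  simp only [interleavings, Finset.mem_filter, Finset.mem_univ, true_and] at hγ
  choose pile hpile using exists_inPile (m := m) hb
  refine ⟨fun s => pile (γ s), ?_, ?_⟩
  · ext i
    have h1 : (Finset.univ.filter fun s => pile (γ s) = i).map
        (γ.toEmbedding.trans Fin.valEmbedding) =
          Finset.Ico (∑ j ∈ Finset.Iio i, b j) (∑ j ∈ Finset.Iic i, b j) := by
      ext c
      simp only [Finset.mem_map, Finset.mem_filter, Finset.mem_univ, true_and, Finset.mem_Ico]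
      constructor
      · rintro ⟨s, rfl, rfl⟩
        exact hpile (γ s)
      · intro hc
        have hcm : c < m := hc.2.trans_le <| by
          rw [← hb]; exact Finset.sum_le_sum_of_subset (Finset.subset_univ _)
        refine ⟨γ.symm ⟨c, hcm⟩, ?_, by simp⟩
        rw [γ.apply_symm_apply]
        exact (hpile _).unique hc
    rw [letterCount, ← Finset.card_map (γ.toEmbedding.trans Fin.valEmbedding), h1, Nat.card_Ico]
    have : Finset.Iic i = insert i (Finset.Iio i) := by
      ext j; simp [le_iff_eq_or_lt]
    rw [this, Finset.sum_insert (by simp)]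
    omega
  · intro s t hst
    constructor
    · intro h
      by_contra hlt
      exact absurd h ((hpile _).lt_of_lt (hpile _) (not_le.1 hlt)).asymm
    · intro h
      rcases h.lt_or_eq with h | h
      · exact (hpile _).lt_of_lt (hpile _) h
      · change pile (γ s) = pile (γ t) at h
        by_contra hlt
        have hne : γ t < γ s :=
          lt_of_le_of_ne (not_lt.1 hlt) fun e => hst.ne (γ.injective e).symm
        have h3 := hγ (pile (γ s)) (γ t) (γ s) (h ▸ hpile _) (hpile _) hne
        simp only [Equiv.symm_apply_apply] at h3
        exact absurd hst h3.asymm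

theorem Ranks.word_unique {a m : ℕ} {γ : Equiv.Perm (Fin m)} {w w' : Fin m → Fin a}
    (h : Ranks γ w) (h' : Ranks γ w') (hw : letterCount w = letterCount w') : w = w' := by
  ext1 s
  rw [← h.inPile_iff, hw, h'.inPile_iff]

/-- The number of words with prescribed letter counts is a multinomial coefficient: compare
coefficients in two expansions of `(∑ i, X i) ^ m`. -/
theorem card_letterCount_eq {a m : ℕ} {b : Fin a → ℕ} (hb : ∑ i, b i = m) :
    (Finset.univ.filter fun w : Fin m → Fin a => letterCount w = b).card =
      Nat.multinomial Finset.univ b := by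
  classical
  have hmon : ∀ c : Fin a → ℕ, ∏ i, (MvPolynomial.X i : MvPolynomial (Fin a) ℕ) ^ c i =
      MvPolynomial.monomial (Finsupp.equivFunOnFinite.symm c) 1 := by
    intro c
    rw [MvPolynomial.monomial_eq, Finsupp.prod_fintype _ _ (by simp)]
    simp
  have hword : ∀ w : Fin m → Fin a, ∏ s, (MvPolynomial.X (w s) : MvPolynomial (Fin a) ℕ) =
      ∏ i, MvPolynomial.X i ^ letterCount w i := by
    intro w
    rw [← Finset.prod_fiberwise (s := Finset.univ) (g := w)]
    refine Finset.prod_congr rfl fun i _ => ?_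
    rw [Finset.prod_congr rfl (g := fun _ => MvPolynomial.X i), Finset.prod_const, letterCount]
    intro s hs
    rw [(Finset.mem_filter.1 hs).2]
  have h1 : (∑ i : Fin a, (MvPolynomial.X i : MvPolynomial (Fin a) ℕ)) ^ m =
      ∑ w : Fin m → Fin a, ∏ s, MvPolynomial.X (w s) := Fintype.sum_pow _ _
  have h2 := Finset.sum_pow_eq_sum_piAntidiag (Finset.univ : Finset (Fin a))
    (fun i => (MvPolynomial.X i : MvPolynomial (Fin a) ℕ)) m
  rw [h1] at h2
  have h3 := congrArg (MvPolynomial.coeff (Finsupp.equivFunOnFinite.symm b)) h2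
  simp only [hword, hmon, MvPolynomial.coeff_sum, MvPolynomial.coeff_monomial,
    EmbeddingLike.apply_eq_iff_eq] at h3
  rw [Finset.card_filter]
  refine (Eq.trans ?_ h3).trans ?_
  · simp
  · simp only [← map_natCast (MvPolynomial.C (σ := Fin a) (R := ℕ)), MvPolynomial.coeff_C_mul,
      MvPolynomial.coeff_monomial, EmbeddingLike.apply_eq_iff_eq]
    simp [Finset.sum_ite_eq', Finset.mem_piAntidiag, hb]

theorem card_interleavings {a m : ℕ} {b : Fin a → ℕ} (hb : ∑ i, b i = m) :
    (interleavings m b).card = Nat.multinomial Finset.univ b := by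
  rw [← card_letterCount_eq hb]
  symm
  refine Finset.card_bij (fun w _ => ranking w) ?_ ?_ ?_
  · intro w hw
    have := (ranks_ranking w).mem_interleavings
    rwa [(Finset.mem_filter.1 hw).2] at this
  · intro w hw w' hw' h
    refine (ranks_ranking w).word_unique (h ▸ ranks_ranking w') ?_
    rw [(Finset.mem_filter.1 hw).2, (Finset.mem_filter.1 hw').2]
  · intro γ hγ
    obtain ⟨w, hw, h⟩ := exists_ranks_of_mem_interleavings hb hγ
    exact ⟨w, by simp [hw], (ranks_ranking w).perm_unique h⟩

/-- The law of a word of `m` independent letters with distribution `p`. -/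
noncomputable def wordLaw {a : ℕ} (p : PMF (Fin a)) (m : ℕ) : Measure (Fin m → Fin a) :=
  Measure.pi fun _ => p.toMeasure

instance {a : ℕ} (p : PMF (Fin a)) (m : ℕ) : IsProbabilityMeasure (wordLaw p m) := by
  unfold wordLaw; infer_instance

theorem prod_word_eq {a m : ℕ} (p : PMF (Fin a)) (w : Fin m → Fin a) :
    ∏ s, p (w s) = ∏ i, p i ^ letterCount w i := by
  rw [← Finset.prod_fiberwise (s := Finset.univ) (g := w)]
  refine Finset.prod_congr rfl fun i _ => ?_
  rw [Finset.prod_congr rfl (g := fun _ => p i), Finset.prod_const, letterCount]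
  intro s hs
  rw [(Finset.mem_filter.1 hs).2]

theorem riffle_apply {a m : ℕ} (p : PMF (Fin a)) (γ : Equiv.Perm (Fin m)) :
    riffle p m γ = ∑ w with ranking w = γ, ∏ s, p (w s) := by
  classical
  rw [riffle, PMF.bind_apply, tsum_eq_sum (s := Finset.piAntidiag Finset.univ m)]
  swap
  · intro b hb
    rw [pileSizes, PMF.ofFinset_apply, if_neg, zero_mul]
    intro h
    exact hb (Finset.mem_piAntidiag.2 ⟨h, by simp⟩)
  rw [← Finset.sum_fiberwise_of_maps_to (g := letterCount) (t := Finset.piAntidiag Finset.univ m)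
    (fun w _ => Finset.mem_piAntidiag.2 ⟨sum_letterCount_univ w, by simp⟩)]
  refine Finset.sum_congr rfl fun b hb => ?_
  have hb : ∑ i, b i = m := (Finset.mem_piAntidiag.1 hb).1
  rw [pileSizes, PMF.ofFinset_apply, if_pos hb, PMF.uniformOfFinset_apply, card_interleavings hb,
    Finset.sum_congr rfl (g := fun _ => ∏ i, p i ^ b i)
      (fun w hw => by rw [prod_word_eq, (Finset.mem_filter.1 hw).2]), Finset.sum_const]
  by_cases hγ : γ ∈ interleavings m b
  · obtain ⟨w, hw, h⟩ := exists_ranks_of_mem_interleavings hb hγ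
    have hone : ((Finset.univ.filter fun w : Fin m → Fin a => ranking w = γ).filter
        fun w => letterCount w = b) = {w} := by
      ext w'
      simp only [Finset.mem_filter, Finset.mem_univ, true_and, Finset.mem_singleton]
      constructor
      · rintro ⟨rfl, h2⟩
        exact (ranks_ranking w').word_unique h (h2.trans hw.symm)
      · rintro rfl
        exact ⟨(ranks_ranking w').perm_unique h, hw⟩
    rw [if_pos hγ, hone, Finset.card_singleton, one_smul, mul_right_comm, ENNReal.mul_inv_cancel,
      one_mul]
    · exact_mod_cast (Nat.multinomial_pos _ _).ne'
    · exact ENNReal.natCast_ne_top _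
  · have hzero : ((Finset.univ.filter fun w : Fin m → Fin a => ranking w = γ).filter
        fun w => letterCount w = b) = ∅ := by
      refine Finset.eq_empty_of_forall_notMem fun w hw => hγ ?_
      simp only [Finset.mem_filter, Finset.mem_univ, true_and] at hw
      obtain ⟨rfl, rfl⟩ := hw
      exact (ranks_ranking w).mem_interleavings
    rw [if_neg hγ, hzero]
    simp

/-- The riffle shuffle is the ranking of a word of independent letters. -/
theorem treeLaw_eq_map {a : ℕ} (p : PMF (Fin a)) (n : ℕ) :
    treeLaw p n = (wordLaw p (n - 1)).map ranking := by
  classical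
  refine Measure.ext_of_singleton fun γ => ?_
  rw [treeLaw, PMF.toMeasure_apply_singleton _ _ (measurableSet_singleton _), riffle_apply,
    Measure.map_apply (measurable_of_finite _) (measurableSet_singleton _)]
  have : ranking ⁻¹' {γ} =
      (↑(Finset.univ.filter fun w : Fin (n - 1) → Fin a => ranking w = γ) :
        Set (Fin (n - 1) → Fin a)) := by
    ext w; simp
  rw [this, ← sum_measure_singleton]
  refine Finset.sum_congr rfl fun w _ => ?_
  rw [wordLaw, Measure.pi_singleton]
  exact Finset.prod_congr rfl fun s _ =>
    (PMF.toMeasure_apply_singleton _ _ (measurableSet_singleton _)).symm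


/-! ### Descendants in terms of positions -/

theorem parent_spec {m : ℕ} (γ : Equiv.Perm (Fin m)) (t : Fin m) :
    (parent γ (γ t) = 0 ∧ ∀ u < t, ¬ γ u < γ t) ∨
      ∃ s < t, parent γ (γ t) = (γ s).succ ∧ γ s < γ t ∧ ∀ u, s < u → u < t → ¬ γ u < γ t := by
  by_cases h : (smallerLeft γ (γ t)).Nonempty
  · right
    have hmem : (smallerLeft γ (γ t)).max' h < t ∧ γ ((smallerLeft γ (γ t)).max' h) < γ t := by
      simpa only [smallerLeft, Finset.mem_filter, Finset.mem_univ, true_and,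
        Equiv.symm_apply_apply] using Finset.max'_mem _ h
    refine ⟨(smallerLeft γ (γ t)).max' h, hmem.1, by rw [parent, dif_pos h], hmem.2, ?_⟩
    intro u hu hut hlt
    have := Finset.le_max' (smallerLeft γ (γ t)) u (by simp [smallerLeft, hut, hlt])
    exact absurd hu (not_lt.2 this)
  · left
    refine ⟨by rw [parent, dif_neg h], fun u hut hlt => h ⟨u, by simp [smallerLeft, hut, hlt]⟩⟩

theorem isChild_succ_iff {m : ℕ} (γ : Equiv.Perm (Fin m)) (v : Fin (m + 1)) (t : Fin m) :
    IsChild γ v (γ t).succ ↔ v = parent γ (γ t) := by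
  constructor
  · rintro ⟨c, hc, rfl⟩
    rw [Fin.succ_inj.1 hc]
  · intro h
    exact ⟨γ t, rfl, h⟩

/-- The descendants of the card at position `s` sit at the positions right after `s`, up to the
first card smaller than it. -/
theorem transGen_succ_iff {m : ℕ} (γ : Equiv.Perm (Fin m)) (s t : Fin m) :
    Relation.TransGen (IsChild γ) (γ s).succ (γ t).succ ↔
      s < t ∧ ∀ u, s < u → u ≤ t → γ s < γ u := by
  constructor
  · intro h
    suffices H : ∀ w, Relation.TransGen (IsChild γ) (γ s).succ w →
        ∃ t, w = (γ t).succ ∧ s < t ∧ ∀ u, s < u → u ≤ t → γ s < γ u by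
      obtain ⟨t', h1, h2⟩ := H _ h
      rw [Fin.succ_inj] at h1
      rwa [γ.injective h1]
    have step : ∀ r t, IsChild γ (γ r).succ (γ t).succ →
        r < t ∧ ∀ u, r < u → u ≤ t → γ r < γ u := by
      intro r t h
      rw [isChild_succ_iff] at h
      rcases parent_spec γ t with ⟨h0, -⟩ | ⟨r', hr, hp, hlt, hu⟩
      · rw [h0] at h; exact absurd h (Fin.succ_ne_zero _)
      · rw [hp, Fin.succ_inj] at h
        obtain rfl := γ.injective h
        refine ⟨hr, fun u h1 h2 => ?_⟩
        rcases h2.lt_or_eq with h2 | rfl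
        · exact hlt.trans_le (not_lt.1 (hu u h1 h2))
        · exact hlt
    intro w hw
    induction hw with
    | single h =>
      obtain ⟨c, rfl, hc⟩ := h
      obtain ⟨t, rfl⟩ := γ.surjective c
      exact ⟨t, rfl, step s t ((isChild_succ_iff _ _ _).2 hc)⟩
    | tail _ h ih =>
      obtain ⟨r, rfl, hr, hru⟩ := ih
      obtain ⟨c, rfl, hc⟩ := h
      obtain ⟨t, rfl⟩ := γ.surjective c
      obtain ⟨h1, h2⟩ := step r t ((isChild_succ_iff _ _ _).2 hc)
      refine ⟨t, rfl, hr.trans h1, fun u hu hut => ?_⟩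
      rcases le_or_gt u r with h3 | h3
      · exact hru u hu h3
      · exact (hru r hr le_rfl).trans (h2 u h3 hut)
  · intro ⟨hst, hu⟩
    induction t using WellFoundedLT.induction with
    | ind t ih =>
      rcases parent_spec γ t with ⟨-, h0⟩ | ⟨r, hr, hp, hlt, hru⟩
      · exact absurd (hu t hst le_rfl) (h0 s hst)
      · have hch : IsChild γ (γ r).succ (γ t).succ := (isChild_succ_iff _ _ _).2 hp.symm
        rcases lt_trichotomy s r with h | rfl | h
        · exact (ih r hr h fun u h1 h2 => hu u h1 (h2.trans hr.le)).tail hch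
        · exact .single hch
        · exact absurd (hu t hst le_rfl) (hru s h hst)

theorem transGen_zero {m : ℕ} (γ : Equiv.Perm (Fin m)) (t : Fin m) :
    Relation.TransGen (IsChild γ) 0 (γ t).succ := by
  induction t using WellFoundedLT.induction with
  | ind t ih =>
    rcases parent_spec γ t with ⟨h0, -⟩ | ⟨r, hr, hp, -⟩
    · exact .single ((isChild_succ_iff _ _ _).2 h0.symm)
    · exact (ih r hr).tail ((isChild_succ_iff _ _ _).2 hp.symm)

theorem not_transGen_zero {m : ℕ} (γ : Equiv.Perm (Fin m)) (v : Fin (m + 1)) :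
    ¬ Relation.TransGen (IsChild γ) v 0 := by
  intro h
  cases h with
  | single h => obtain ⟨c, hc, -⟩ := h; exact Fin.succ_ne_zero _ hc.symm
  | tail _ h => obtain ⟨c, hc, -⟩ := h; exact Fin.succ_ne_zero _ hc.symm

theorem ncard_descendants_zero {m : ℕ} (γ : Equiv.Perm (Fin m)) :
    (descendants γ 0).ncard = m := by
  have : descendants γ 0 = Set.range (Fin.succ : Fin m → Fin (m + 1)) := by
    ext w
    refine Fin.cases ?_ (fun c => ?_) w
    · simp only [descendants, Set.mem_ofPred_eq, not_transGen_zero, Set.mem_range, false_iff]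
      rintro ⟨c, hc⟩
      exact Fin.succ_ne_zero _ hc
    · obtain ⟨t, rfl⟩ := γ.surjective c
      simp [descendants, transGen_zero]
  rw [this, Set.ncard_eq_toFinset_card', Set.toFinset_range,
    Finset.card_image_of_injective _ (Fin.succ_injective m)]
  simp

theorem le_ncard_descendants_succ_iff {m : ℕ} (γ : Equiv.Perm (Fin m)) (s : Fin m) (k : ℕ) :
    k ≤ (descendants γ (γ s).succ).ncard ↔
      (s : ℕ) + k < m ∧ ∀ u, s < u → (u : ℕ) ≤ s + k → γ s < γ u := by
  classical
  have hset : descendants γ (γ s).succ =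
      ((Finset.univ.filter fun t => s < t ∧ ∀ u, s < u → u ≤ t → γ s < γ u).map
        (γ.toEmbedding.trans (Fin.succEmb m)) : Finset (Fin (m + 1))) := by
    ext w
    refine Fin.cases ?_ (fun c => ?_) w
    · simp [descendants, not_transGen_zero]
    · obtain ⟨t, rfl⟩ := γ.surjective c
      simp [descendants, transGen_succ_iff]
  rw [hset, Set.ncard_coe_finset, Finset.card_map]
  constructor
  · intro h
    by_contra hcon
    -- A bound on the positions that can carry descendants.
    obtain ⟨e, he, hes, hbd⟩ : ∃ e : ℕ, e < s + k + 1 ∧ (s : ℕ) < e ∧ ∀ t : Fin m, s < t →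
        (∀ u, s < u → u ≤ t → γ s < γ u) → (t : ℕ) < e := by
      by_cases hm : (s : ℕ) + k < m
      · have : ∃ u, s < u ∧ (u : ℕ) ≤ s + k ∧ ¬ γ s < γ u := by
          by_contra hno
          push Not at hno
          exact hcon ⟨hm, fun u h1 h2 => hno u h1 h2⟩
        obtain ⟨u, h1, h2, h3⟩ := this
        exact ⟨u, by omega, h1, fun t _ ht => Fin.lt_def.1 (not_le.1 fun hle => h3 (ht u h1 hle))⟩
      · exact ⟨m, by omega, s.2, fun t _ _ => t.2⟩
    have h2 : ((Finset.univ.filter fun t => s < t ∧ ∀ u, s < u → u ≤ t → γ s < γ u).map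
        Fin.valEmbedding).card ≤ (Finset.Ioo (s : ℕ) e).card := by
      refine Finset.card_le_card fun x hx => ?_
      simp only [Finset.mem_map, Finset.mem_filter, Finset.mem_univ, true_and] at hx
      obtain ⟨t, ⟨h1, h2⟩, rfl⟩ := hx
      exact Finset.mem_Ioo.2 ⟨h1, hbd t h1 h2⟩
    rw [Finset.card_map, Nat.card_Ioo] at h2
    omega
  · rintro ⟨hm, h⟩
    have h2 : (Finset.Ioc (s : ℕ) (s + k)).card ≤
        ((Finset.univ.filter fun t => s < t ∧ ∀ u, s < u → u ≤ t → γ s < γ u).map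
        Fin.valEmbedding).card := by
      refine Finset.card_le_card fun x hx => ?_
      simp only [Finset.mem_map, Finset.mem_filter, Finset.mem_univ, true_and]
      rw [Finset.mem_Ioc] at hx
      refine ⟨⟨x, by omega⟩, ⟨Fin.lt_def.2 hx.1, fun u h1 h2 => h u h1 ?_⟩, rfl⟩
      exact le_trans (Fin.le_def.1 h2) hx.2
    rw [Finset.card_map, Nat.card_Ioc] at h2
    omega

open scoped Classical in
/-- The indicator of the event that the letters of `w` at the `k` positions after position `s` are
at least as large as the letter at `s`. -/
noncomputable def minInd {a m : ℕ} (k s : ℕ) (w : Fin m → Fin a) : ℝ :=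
  if ∀ r t : Fin m, (r : ℕ) = s → s < t → (t : ℕ) ≤ s + k → w r ≤ w t then 1 else 0

/-- Besides the root, the nodes with at least `k` descendants are the local minima over windows of
length `k + 1` of the word whose ranking is `γ`. -/
theorem numAtLeast_ranks {a m : ℕ} {γ : Equiv.Perm (Fin m)} {w : Fin m → Fin a} (h : Ranks γ w)
    (k : ℕ) : (numAtLeast k γ : ℝ) =
      (if k ≤ m then 1 else 0) + ∑ s ∈ Finset.range (m - k), minInd k s w := by
  classical
  have hset : {v : Fin (m + 1) | k ≤ (descendants γ v).ncard} =
      ((Finset.univ.filter fun v => k ≤ (descendants γ v).ncard : Finset (Fin (m + 1))) :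
        Set (Fin (m + 1))) := by simp
  rw [numAtLeast, hset, Set.ncard_coe_finset, Finset.card_filter, Fin.sum_univ_succ,
    ncard_descendants_zero]
  push_cast
  congr 1
  have key : ∀ s : Fin m, (if k ≤ (descendants γ (γ s).succ).ncard then 1 else 0 : ℝ) =
      if (s : ℕ) < m - k then minInd k s w else 0 := by
    intro s
    simp only [le_ncard_descendants_succ_iff]
    by_cases hm : (s : ℕ) + k < m
    · rw [if_pos (show (s : ℕ) < m - k by omega), minInd]
      refine if_congr ?_ rfl rfl
      constructor
      · rintro ⟨-, h1⟩ r t hr hst htk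
        obtain rfl := Fin.ext hr
        exact (h r t hst).1 (h1 t hst htk)
      · intro h1
        exact ⟨hm, fun u hu huk => (h s u hu).2 (h1 s u rfl hu huk)⟩
    · rw [if_neg (show ¬ (s : ℕ) < m - k by omega), if_neg (fun h => hm h.1)]
  rw [← Equiv.sum_comp γ, Finset.sum_congr rfl fun s _ => key s,
    Fin.sum_univ_eq_sum_range (fun s => if s < m - k then minInd k s w else 0) m,
    ← Finset.sum_filter]
  congr 1
  ext s
  simp only [Finset.mem_filter, Finset.mem_range]
  omega


/-! ### A lower bound for weighted sums of autocovariances -/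

theorem pow_sub_pow_succ_ge {s : ℝ} (hs0 : 0 ≤ s) (hs1 : s ≤ 1) {j k : ℕ} (hjk : j ≤ k) :
    ((k : ℝ) + 1 - j) * (1 - s) * s ^ k ≤ s ^ j - s ^ (k + 1) := by
  induction k, hjk using Nat.le_induction with
  | base => rw [pow_succ]; ring_nf; exact le_rfl
  | succ k hk ih =>
    have h1 : s ^ (k + 1) ≤ s ^ k := pow_le_pow_of_le_one hs0 hs1 (Nat.le_succ k)
    have h2 : 0 ≤ (k : ℝ) + 1 - j := by
      have : (j : ℝ) ≤ k := by exact_mod_cast hk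
      linarith
    have h3 : ((k : ℝ) + 1 - j) * (1 - s) * s ^ (k + 1) ≤ ((k : ℝ) + 1 - j) * (1 - s) * s ^ k :=
      mul_le_mul_of_nonneg_left h1 (mul_nonneg h2 (by linarith))
    have h4 : s ^ (k + 1 + 1) = s ^ (k + 1) * s := pow_succ _ _
    push_cast
    nlinarith

/-- Damping the weights by a geometric factor only shifts mass to small indices. -/
theorem sum_weights_pow_nonneg {k : ℕ} {w : ℕ → ℝ} (hw : ∀ j, 0 ≤ w j) {c : ℝ} (hc : 0 ≤ c)
    (h : 0 ≤ ∑ j ∈ Finset.Icc 1 k, w j * (c - j)) {u : ℝ} (hu0 : 0 ≤ u) (hu1 : u ≤ 1) :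
    0 ≤ ∑ j ∈ Finset.Icc 1 k, w j * u ^ j * (c - j) := by
  have h1 : ∑ j ∈ Finset.Icc 1 k, w j * u ^ ⌊c⌋₊ * (c - j) ≤
      ∑ j ∈ Finset.Icc 1 k, w j * u ^ j * (c - j) := by
    refine Finset.sum_le_sum fun j _ => ?_
    rcases le_or_gt j ⌊c⌋₊ with hj | hj
    · have h2 : (j : ℝ) ≤ c := (Nat.le_floor_iff hc).1 hj
      exact mul_le_mul_of_nonneg_right (mul_le_mul_of_nonneg_left
        (pow_le_pow_of_le_one hu0 hu1 hj) (hw j)) (by linarith)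
    · have h2 : c < j := (Nat.floor_lt hc).1 hj
      exact mul_le_mul_of_nonpos_right (mul_le_mul_of_nonneg_left
        (pow_le_pow_of_le_one hu0 hu1 hj.le) (hw j)) (by linarith)
  refine le_trans ?_ h1
  have : ∑ j ∈ Finset.Icc 1 k, w j * u ^ ⌊c⌋₊ * (c - j) =
      u ^ ⌊c⌋₊ * ∑ j ∈ Finset.Icc 1 k, w j * (c - j) := by
    rw [Finset.mul_sum]; exact Finset.sum_congr rfl fun j _ => by ring
  rw [this]
  exact mul_nonneg (pow_nonneg hu0 _) h

/-- The effect of adding an atom of mass `1 - s` below all others, for a single index `j`: here `m`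
is the old and `1 - s + s ^ (k + 1) * m` the new mean. -/
theorem add_atom_bound {s m δ : ℝ} (hs0 : 0 ≤ s) (hs1 : s ≤ 1) (hm : 0 ≤ m) (hδ : 0 ≤ δ)
    {j k : ℕ} (hj : 1 ≤ j) (hjk : j ≤ k) :
    (1 - s) * s * (δ - (1 + δ) * (s ^ k * m) + (1 + δ) * ((k : ℝ) + 1 - j) * (s ^ k * m) ^ 2) ≤
      (1 - s) * (1 - s + s ^ (k + 1) * m) + s ^ (k + 1 + j) * (m ^ 2 - δ * (m * (1 - m))) -
        ((1 - s + s ^ (k + 1) * m) ^ 2 -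
          δ * ((1 - s + s ^ (k + 1) * m) * (1 - (1 - s + s ^ (k + 1) * m)))) := by
  have h1 := pow_sub_pow_succ_ge hs0 hs1 hjk
  have h2 : s ^ j ≤ s := by simpa using pow_le_pow_of_le_one hs0 hs1 hj
  have ht : 0 ≤ s ^ k := pow_nonneg hs0 k
  rw [pow_add s (k + 1) j]
  rw [pow_succ s k] at h1 ⊢
  generalize s ^ k = t at *
  generalize s ^ j = q at *
  have h3 : 0 ≤ t * s * m ^ 2 * (1 + δ) := by positivity
  have h4 := mul_le_mul_of_nonneg_left h1 h3
  have h5 : 0 ≤ t * s * m * δ := by positivity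
  have h6 := mul_le_mul_of_nonneg_left h2 h5
  nlinarith

/-- The inductive step: a quadratic lower bound for all geometrically damped weighted sums of the
`t j` survives the addition of an atom. -/
theorem add_atom_sum_bound {s m δ lam : ℝ} (hs0 : 0 ≤ s) (hs1 : s ≤ 1) (hm : 0 ≤ m) (hδ : 0 ≤ δ)
    {k : ℕ} {w t : ℕ → ℝ} (hw : ∀ j, 0 ≤ w j) (hlam : lam ≤ k + 1)
    (hsum : 0 ≤ ∑ j ∈ Finset.Icc 1 k, w j * ((k : ℝ) + 1 - lam - j))
    (hlamδ : 1 + δ ≤ 4 * lam * δ)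
    (ih : ∀ u : ℝ, 0 ≤ u → u ≤ 1 →
      0 ≤ ∑ j ∈ Finset.Icc 1 k, w j * u ^ j * (t j - (m ^ 2 - δ * (m * (1 - m)))))
    (u : ℝ) (hu0 : 0 ≤ u) (hu1 : u ≤ 1) :
    0 ≤ ∑ j ∈ Finset.Icc 1 k, w j * u ^ j *
      ((1 - s) * (1 - s + s ^ (k + 1) * m) + s ^ (k + 1 + j) * t j -
        ((1 - s + s ^ (k + 1) * m) ^ 2 -
          δ * ((1 - s + s ^ (k + 1) * m) * (1 - (1 - s + s ^ (k + 1) * m))))) := by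
  have hus0 : 0 ≤ u * s := mul_nonneg hu0 hs0
  have hus1 : u * s ≤ 1 := mul_le_one₀ hu1 hs0 hs1
  set z := s ^ k * m with hz
  have hterm : ∀ j ∈ Finset.Icc 1 k,
      s ^ (k + 1) * (w j * (u * s) ^ j * (t j - (m ^ 2 - δ * (m * (1 - m))))) +
      (1 - s) * s * (w j * u ^ j * (δ - (1 + δ) * z + (1 + δ) * lam * z ^ 2) +
        (1 + δ) * z ^ 2 * (w j * u ^ j * ((k : ℝ) + 1 - lam - j))) ≤
      w j * u ^ j *
      ((1 - s) * (1 - s + s ^ (k + 1) * m) + s ^ (k + 1 + j) * t j -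
        ((1 - s + s ^ (k + 1) * m) ^ 2 -
          δ * ((1 - s + s ^ (k + 1) * m) * (1 - (1 - s + s ^ (k + 1) * m))))) := by
    intro j hj
    rw [Finset.mem_Icc] at hj
    have h1 := mul_le_mul_of_nonneg_left (add_atom_bound hs0 hs1 hm hδ hj.1 hj.2)
      (mul_nonneg (hw j) (pow_nonneg hu0 j))
    rw [← hz] at h1
    rw [mul_pow]
    rw [pow_add s (k + 1) j] at h1 ⊢
    linarith
  refine le_trans ?_ (Finset.sum_le_sum hterm)
  rw [Finset.sum_add_distrib, ← Finset.mul_sum, ← Finset.mul_sum, Finset.sum_add_distrib,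
    ← Finset.mul_sum, ← Finset.sum_mul]
  have hA := ih (u * s) hus0 hus1
  have hB := sum_weights_pow_nonneg hw (by linarith) hsum hu0 hu1
  have hC : 0 ≤ ∑ j ∈ Finset.Icc 1 k, w j * u ^ j :=
    Finset.sum_nonneg fun j _ => mul_nonneg (hw j) (pow_nonneg hu0 j)
  have hD : 0 ≤ δ - (1 + δ) * z + (1 + δ) * lam * z ^ 2 := by
    -- The discriminant of this quadratic in `z` is nonpositive.
    have hδ0 : 0 < δ := by
      rcases hδ.lt_or_eq with h | h
      · exact h
      · rw [← h] at hlamδ; norm_num at hlamδ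
    have h1 : 0 ≤ (1 + δ) * z ^ 2 * (4 * lam * δ - (1 + δ)) :=
      mul_nonneg (by positivity) (by linarith)
    have h2 : 0 ≤ (2 * δ - (1 + δ) * z) ^ 2 := sq_nonneg _
    by_contra hneg
    have h3 := mul_neg_of_pos_of_neg (by linarith : 0 < 4 * δ) (not_le.1 hneg)
    nlinarith
  have hs' : 0 ≤ (1 - s) * s := mul_nonneg (by linarith) hs0
  have hz2 : 0 ≤ (1 + δ) * z ^ 2 := by positivity
  have h1 := mul_nonneg (pow_nonneg hs0 (k + 1)) hA
  have h2 := mul_nonneg hs' (add_nonneg (mul_nonneg hC hD) (mul_nonneg hz2 hB))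
  linarith

/-- Total mass of the first `n` atoms. -/
noncomputable def mass (q : ℕ → ℝ) (n : ℕ) : ℝ := ∑ i ∈ Finset.range n, q i

/-- `∑ q_i G_i ^ k` over the first `n` atoms, where `G_i` is the mass of the atoms up to the
`i`-th. -/
noncomputable def windowMass (q : ℕ → ℝ) (k n : ℕ) : ℝ :=
  ∑ i ∈ Finset.range n, q i * mass q (i + 1) ^ k

/-- `∑ q_i G_i ^ (j - 1) H_i` over the first `n` atoms, where `H_i` is the `windowMass` of the atoms
up to the `i`-th. -/
noncomputable def pairMass (q : ℕ → ℝ) (k j n : ℕ) : ℝ :=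
  ∑ i ∈ Finset.range n, q i * mass q (i + 1) ^ (j - 1) * windowMass q k (i + 1)

theorem mass_pos {q : ℕ → ℝ} {n : ℕ} (hq : ∀ i < n, 0 < q i) (hn : n ≠ 0) : 0 < mass q n :=
  Finset.sum_pos (fun i hi => hq i (Finset.mem_range.1 hi)) (by simpa using hn)

theorem mass_nonneg {q : ℕ → ℝ} {n : ℕ} (hq : ∀ i < n, 0 < q i) : 0 ≤ mass q n :=
  Finset.sum_nonneg fun i hi => (hq i (Finset.mem_range.1 hi)).le

theorem windowMass_nonneg {q : ℕ → ℝ} {k n : ℕ} (hq : ∀ i < n, 0 < q i) :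
    0 ≤ windowMass q k n := by
  refine Finset.sum_nonneg fun i hi => ?_
  have hi := Finset.mem_range.1 hi
  exact mul_nonneg (hq i hi).le (pow_nonneg (mass_nonneg fun l hl => hq l (by omega)) _)

/-- The quadratic lower bound for damped weighted sums, with all quantities normalized by the total
mass. The atoms are added one at a time, each below the previous ones. -/
theorem damped_sum_bound {δ lam : ℝ} (hδ : 0 ≤ δ) {k : ℕ} {w : ℕ → ℝ} (hw : ∀ j, 0 ≤ w j)
    (hlam : lam ≤ k + 1)
    (hsum : 0 ≤ ∑ j ∈ Finset.Icc 1 k, w j * ((k : ℝ) + 1 - lam - j))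
    (hlamδ : 1 + δ ≤ 4 * lam * δ) (q : ℕ → ℝ) (n : ℕ) (hq : ∀ i < n + 1, 0 < q i)
    (u : ℝ) (hu0 : 0 ≤ u) (hu1 : u ≤ 1) :
    0 ≤ ∑ j ∈ Finset.Icc 1 k, w j * u ^ j *
      (pairMass q k j (n + 1) / mass q (n + 1) ^ (k + 1 + j) -
        ((windowMass q k (n + 1) / mass q (n + 1) ^ (k + 1)) ^ 2 -
          δ * ((windowMass q k (n + 1) / mass q (n + 1) ^ (k + 1)) *
            (1 - windowMass q k (n + 1) / mass q (n + 1) ^ (k + 1))))) := by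
  induction n generalizing u with
  | zero =>
    refine (Finset.sum_eq_zero fun j hj => ?_).ge
    have h0 : q 0 ≠ 0 := (hq 0 (by omega)).ne'
    rw [Finset.mem_Icc] at hj
    have h1 : windowMass q k (0 + 1) / mass q (0 + 1) ^ (k + 1) = 1 := by
      simp only [windowMass, mass, Finset.range_one, Finset.sum_singleton, zero_add]
      rw [← pow_succ', div_self (pow_ne_zero _ h0)]
    have h2 : pairMass q k j (0 + 1) / mass q (0 + 1) ^ (k + 1 + j) = 1 := by
      obtain ⟨i, rfl⟩ : ∃ i, j = i + 1 := ⟨j - 1, by omega⟩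
      simp only [pairMass, windowMass, mass, Finset.range_one, Finset.sum_singleton, zero_add,
        Nat.add_sub_cancel]
      rw [div_eq_one_iff_eq (pow_ne_zero _ h0)]
      ring
    rw [h1, h2]
    ring
  | succ n ih =>
    have hq' : ∀ i < n + 1, 0 < q i := fun i hi => hq i (by omega)
    have ih := ih hq'
    have hg : 0 < mass q (n + 1) := mass_pos hq' (by omega)
    have hg' : 0 < mass q (n + 1 + 1) := mass_pos hq (by omega)
    have hgg : mass q (n + 1 + 1) = mass q (n + 1) + q (n + 1) := Finset.sum_range_succ _ _
    have hqn := hq (n + 1) (by omega)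
    have hm : 0 ≤ windowMass q k (n + 1) / mass q (n + 1) ^ (k + 1) :=
      div_nonneg (windowMass_nonneg hq') (pow_nonneg hg.le _)
    have hs0 : 0 ≤ mass q (n + 1) / mass q (n + 1 + 1) := by positivity
    have hs1 : mass q (n + 1) / mass q (n + 1 + 1) ≤ 1 := by
      rw [div_le_one hg', hgg]; linarith
    have hmean : windowMass q k (n + 1 + 1) / mass q (n + 1 + 1) ^ (k + 1) =
        1 - mass q (n + 1) / mass q (n + 1 + 1) +
          (mass q (n + 1) / mass q (n + 1 + 1)) ^ (k + 1) *
            (windowMass q k (n + 1) / mass q (n + 1) ^ (k + 1)) := by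
      have h1 : windowMass q k (n + 1 + 1) =
          windowMass q k (n + 1) + q (n + 1) * mass q (n + 1 + 1) ^ k :=
        Finset.sum_range_succ _ _
      have h2 : q (n + 1) = mass q (n + 1 + 1) - mass q (n + 1) := by rw [hgg]; ring
      rw [h1, h2, div_pow, pow_succ (mass q (n + 1 + 1)) k]
      field_simp
      ring
    have hpair : ∀ j ∈ Finset.Icc 1 k,
        pairMass q k j (n + 1 + 1) / mass q (n + 1 + 1) ^ (k + 1 + j) =
        (1 - mass q (n + 1) / mass q (n + 1 + 1)) *
          (windowMass q k (n + 1 + 1) / mass q (n + 1 + 1) ^ (k + 1)) +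
        (mass q (n + 1) / mass q (n + 1 + 1)) ^ (k + 1 + j) *
          (pairMass q k j (n + 1) / mass q (n + 1) ^ (k + 1 + j)) := by
      intro j hj
      rw [Finset.mem_Icc] at hj
      obtain ⟨i, rfl⟩ : ∃ i, j = i + 1 := ⟨j - 1, by omega⟩
      have h1 : pairMass q k (i + 1) (n + 1 + 1) = pairMass q k (i + 1) (n + 1) +
          q (n + 1) * mass q (n + 1 + 1) ^ i * windowMass q k (n + 1 + 1) :=
        Finset.sum_range_succ _ _
      have h2 : q (n + 1) = mass q (n + 1 + 1) - mass q (n + 1) := by rw [hgg]; ring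
      have h3 : mass q (n + 1 + 1) ^ (k + 1 + (i + 1)) =
        mass q (n + 1 + 1) ^ (k + 1) * mass q (n + 1 + 1) ^ i * mass q (n + 1 + 1) := by ring
      rw [h1, h2, div_pow, h3]
      field_simp
      ring
    have := add_atom_sum_bound (t := fun j => pairMass q k j (n + 1) / mass q (n + 1) ^ (k + 1 + j))
      hs0 hs1 hm hδ hw hlam hsum hlamδ ih u hu0 hu1
    refine this.trans_eq (Finset.sum_congr rfl fun j hj => ?_)
    rw [hpair j hj, hmean]

/-- For a probability vector, weighted sums of the autocovariances `pairMass - windowMass ^ 2` are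
bounded below by a multiple of the variance `windowMass * (1 - windowMass)`. -/
theorem weighted_cov_ge {δ lam : ℝ} (hδ : 0 ≤ δ) {k : ℕ} {w : ℕ → ℝ} (hw : ∀ j, 0 ≤ w j)
    (hlam : lam ≤ k + 1)
    (hsum : 0 ≤ ∑ j ∈ Finset.Icc 1 k, w j * ((k : ℝ) + 1 - lam - j))
    (hlamδ : 1 + δ ≤ 4 * lam * δ) {q : ℕ → ℝ} {n : ℕ} (hq : ∀ i < n, 0 < q i)
    (hone : mass q n = 1) :
    -(δ * (windowMass q k n * (1 - windowMass q k n)) * ∑ j ∈ Finset.Icc 1 k, w j) ≤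
      ∑ j ∈ Finset.Icc 1 k, w j * (pairMass q k j n - windowMass q k n ^ 2) := by
  obtain ⟨n, rfl⟩ : ∃ i, n = i + 1 := by
    refine ⟨n - 1, ?_⟩
    rcases n with _ | n
    · simp [mass] at hone
    · simp
  have h := damped_sum_bound hδ hw hlam hsum hlamδ q n hq 1 zero_le_one le_rfl
  simp only [hone, one_pow, div_one, mul_one] at h
  have h2 : ∑ j ∈ Finset.Icc 1 k, w j * (pairMass q k j (n + 1) - (windowMass q k (n + 1) ^ 2 -
      δ * (windowMass q k (n + 1) * (1 - windowMass q k (n + 1))))) =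
      ∑ j ∈ Finset.Icc 1 k, w j * (pairMass q k j (n + 1) - windowMass q k (n + 1) ^ 2) +
      δ * (windowMass q k (n + 1) * (1 - windowMass q k (n + 1))) * ∑ j ∈ Finset.Icc 1 k, w j := by
    rw [Finset.mul_sum, ← Finset.sum_add_distrib]
    exact Finset.sum_congr rfl fun j _ => by ring
  rw [h2] at h
  linarith

theorem sum_Icc_one_id (k : ℕ) : ∑ j ∈ Finset.Icc 1 k, (j : ℝ) = k * (k + 1) / 2 := by
  induction k with
  | zero => simp
  | succ k ih => rw [Finset.sum_Icc_succ_top (by omega), ih]; push_cast; ring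

theorem sum_Icc_one_sq (k : ℕ) :
    ∑ j ∈ Finset.Icc 1 k, (j : ℝ) ^ 2 = k * (k + 1) * (2 * k + 1) / 6 := by
  induction k with
  | zero => simp
  | succ k ih => rw [Finset.sum_Icc_succ_top (by omega), ih]; push_cast; ring

theorem sum_cov_ge {k : ℕ} {q : ℕ → ℝ} {n : ℕ} (hq : ∀ i < n, 0 < q i) (hone : mass q n = 1) :
    -(k / (2 * k + 1) * (windowMass q k n * (1 - windowMass q k n))) ≤
      ∑ j ∈ Finset.Icc 1 k, (pairMass q k j n - windowMass q k n ^ 2) := by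
  have h := weighted_cov_ge (δ := 1 / (2 * k + 1)) (lam := (k + 1) / 2) (k := k) (w := fun _ => 1)
    (by positivity) (fun _ => zero_le_one) (by linarith [Nat.cast_nonneg (α := ℝ) k])
    (by
      simp only [one_mul]
      rw [Finset.sum_sub_distrib, sum_Icc_one_id]
      simp
      nlinarith)
    (by apply le_of_eq; field_simp; ring) hq hone
  simp only [one_mul, Finset.sum_const, Nat.card_Icc, nsmul_eq_mul, mul_one] at h
  refine le_trans (le_of_eq ?_) h
  simp
  ring

theorem sum_mul_cov_ge {k : ℕ} {q : ℕ → ℝ} {n : ℕ} (hq : ∀ i < n, 0 < q i) (hone : mass q n = 1)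
    (hvar : 0 ≤ windowMass q k n * (1 - windowMass q k n)) :
    -(3 / 8 * k * (windowMass q k n * (1 - windowMass q k n))) ≤
      ∑ j ∈ Finset.Icc 1 k, (j : ℝ) * (pairMass q k j n - windowMass q k n ^ 2) := by
  have hk : (0 : ℝ) ≤ k := Nat.cast_nonneg k
  have h := weighted_cov_ge (δ := 3 / (4 * k + 5)) (lam := (k + 2) / 3) (k := k)
    (w := fun j => j) (by positivity) (fun _ => Nat.cast_nonneg _) (by linarith)
    (by
      have : ∑ j ∈ Finset.Icc 1 k, (j : ℝ) * ((k : ℝ) + 1 - (k + 2) / 3 - j) =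
          (∑ j ∈ Finset.Icc 1 k, (j : ℝ)) * ((k : ℝ) + 1 - (k + 2) / 3) -
            ∑ j ∈ Finset.Icc 1 k, (j : ℝ) ^ 2 := by
        rw [Finset.sum_mul, ← Finset.sum_sub_distrib]
        exact Finset.sum_congr rfl fun j _ => by ring
      rw [this, sum_Icc_one_id, sum_Icc_one_sq]
      apply le_of_eq
      ring)
    (by apply le_of_eq; field_simp; ring) hq hone
  refine le_trans ?_ h
  rw [sum_Icc_one_id]
  generalize windowMass q k n * (1 - windowMass q k n) = g at *
  have : 3 / (4 * (k : ℝ) + 5) * g * (k * (k + 1) / 2) =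
      3 / 8 * k * g * ((4 * k + 4) / (4 * k + 5)) := by
    field_simp; ring
  rw [this]
  have h2 : (4 * (k : ℝ) + 4) / (4 * k + 5) ≤ 1 := by rw [div_le_one (by positivity)]; linarith
  have h3 : 0 ≤ 3 / 8 * k * g := by positivity
  nlinarith


/-! ### Stein's equation for the standard normal distribution -/

/-- The density of the standard normal distribution. -/
noncomputable def gaussDensity (x : ℝ) : ℝ := gaussianPDFReal 0 1 x

theorem gaussDensity_eq (x : ℝ) :
    gaussDensity x = (Real.sqrt (2 * Real.pi))⁻¹ * Real.exp (-(1 / 2) * x ^ 2) := by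
  simp only [gaussDensity, gaussianPDFReal, NNReal.coe_one, mul_one, sub_zero]
  congr 2
  ring

theorem gaussDensity_pos (x : ℝ) : 0 < gaussDensity x := gaussianPDFReal_pos _ _ _ one_ne_zero

theorem gaussDensity_le (x : ℝ) : gaussDensity x ≤ 2 / 5 := by
  rw [gaussDensity_eq]
  have h1 : Real.exp (-(1 / 2) * x ^ 2) ≤ 1 := Real.exp_le_one_iff.2 (by nlinarith [sq_nonneg x])
  have h2 : 5 / 2 ≤ Real.sqrt (2 * Real.pi) := by
    apply Real.le_sqrt_of_sq_le
    nlinarith [Real.pi_gt_d2]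
  have h3 : (Real.sqrt (2 * Real.pi))⁻¹ ≤ 2 / 5 := by
    rw [inv_le_comm₀ (by linarith) (by norm_num), inv_div]
    exact h2
  have h4 := Real.exp_pos (-(1 / 2) * x ^ 2)
  nlinarith

theorem hasDerivAt_gaussDensity (x : ℝ) : HasDerivAt gaussDensity (-x * gaussDensity x) x := by
  have h0 : gaussDensity =
      fun x => (Real.sqrt (2 * Real.pi))⁻¹ * Real.exp (-(1 / 2) * x ^ 2) := by
    ext x; exact gaussDensity_eq x
  rw [h0]
  have h1 : HasDerivAt (fun x : ℝ => -(1 / 2) * x ^ 2) (-x) x := by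
    refine ((hasDerivAt_pow 2 x).const_mul (-(1 / 2) : ℝ)).congr_deriv ?_
    push_cast
    ring
  refine (h1.exp.const_mul (Real.sqrt (2 * Real.pi))⁻¹).congr_deriv ?_
  ring

theorem continuous_gaussDensity : Continuous gaussDensity :=
  continuous_iff_continuousAt.2 fun x => (hasDerivAt_gaussDensity x).continuousAt

theorem integrable_gaussDensity : Integrable gaussDensity := integrable_gaussianPDFReal 0 1

theorem integral_gaussDensity : ∫ x, gaussDensity x = 1 :=
  integral_gaussianPDFReal_eq_one 0 one_ne_zero

theorem integrable_id_mul_gaussDensity : Integrable fun x => x * gaussDensity x := by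
  have h := (integrable_mul_exp_neg_mul_sq (b := 1 / 2) (by norm_num)).const_mul
    (Real.sqrt (2 * Real.pi))⁻¹
  refine h.congr (ae_of_all _ fun x => ?_)
  simp only [gaussDensity_eq]
  ring

theorem integrable_sq_mul_gaussDensity : Integrable fun x => x ^ 2 * gaussDensity x := by
  have h := (integrable_rpow_mul_exp_neg_mul_sq (b := 1 / 2) (s := 2) (by norm_num)
    (by norm_num)).const_mul (Real.sqrt (2 * Real.pi))⁻¹
  refine h.congr (ae_of_all _ fun x => ?_)
  simp only [gaussDensity_eq]
  rw [Real.rpow_two]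
  ring

theorem hasDerivAt_neg_id_mul_gaussDensity (x : ℝ) :
    HasDerivAt (fun x => -(x * gaussDensity x)) (x ^ 2 * gaussDensity x - gaussDensity x) x := by
  refine (((hasDerivAt_id' x).mul (hasDerivAt_gaussDensity x)).neg).congr_deriv ?_
  ring

/-- The upper tail of the standard normal distribution. -/
noncomputable def upperTail (x : ℝ) : ℝ := ∫ t in Set.Ioi x, gaussDensity t

/-- The lower tail of the standard normal distribution. -/
noncomputable def lowerTail (x : ℝ) : ℝ := ∫ t in Set.Iic x, gaussDensity t

theorem setIntegral_Iic_add_Ioi {g : ℝ → ℝ} (hg : Integrable g) (x : ℝ) :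
    (∫ t in Set.Iic x, g t) + ∫ t in Set.Ioi x, g t = ∫ t, g t := by
  rw [← setIntegral_union (Set.Iic_disjoint_Ioi le_rfl) measurableSet_Ioi hg.integrableOn
    hg.integrableOn, Set.Iic_union_Ioi, setIntegral_univ]

theorem lowerTail_add_upperTail (x : ℝ) : lowerTail x + upperTail x = 1 := by
  rw [lowerTail, upperTail, setIntegral_Iic_add_Ioi integrable_gaussDensity,
    integral_gaussDensity]

theorem setIntegral_Ioi_id (x : ℝ) : ∫ t in Set.Ioi x, t * gaussDensity t = gaussDensity x := by
  have hd : ∀ t ∈ Set.Ici x, HasDerivAt (fun t => -gaussDensity t) (t * gaussDensity t) t :=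
    fun t _ => (hasDerivAt_gaussDensity t).neg.congr_deriv (by ring)
  have h := integral_Ioi_of_hasDerivAt_of_tendsto' hd
    integrable_id_mul_gaussDensity.integrableOn
    (tendsto_zero_of_hasDerivAt_of_integrableOn_Ioi (fun t ht => hd t (Set.Ioi_subset_Ici_self ht))
      integrable_id_mul_gaussDensity.integrableOn integrable_gaussDensity.neg.integrableOn)
  rw [h]; ring

theorem setIntegral_Iic_id (x : ℝ) : ∫ t in Set.Iic x, t * gaussDensity t = -gaussDensity x := by
  have hd : ∀ t ∈ Set.Iic x, HasDerivAt (fun t => -gaussDensity t) (t * gaussDensity t) t :=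
    fun t _ => (hasDerivAt_gaussDensity t).neg.congr_deriv (by ring)
  have h := integral_Iic_of_hasDerivAt_of_tendsto' hd
    integrable_id_mul_gaussDensity.integrableOn
    (tendsto_zero_of_hasDerivAt_of_integrableOn_Iic hd
      integrable_id_mul_gaussDensity.integrableOn integrable_gaussDensity.neg.integrableOn)
  rw [h]; ring

theorem setIntegral_Ioi_sq (x : ℝ) :
    ∫ t in Set.Ioi x, t ^ 2 * gaussDensity t = x * gaussDensity x + upperTail x := by
  have hi := integrable_sq_mul_gaussDensity.sub integrable_gaussDensity
  have h := integral_Ioi_of_hasDerivAt_of_tendsto' (a := x)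
    (fun t _ => hasDerivAt_neg_id_mul_gaussDensity t) hi.integrableOn
    (tendsto_zero_of_hasDerivAt_of_integrableOn_Ioi (a := x)
      (fun t _ => hasDerivAt_neg_id_mul_gaussDensity t)
      hi.integrableOn integrable_id_mul_gaussDensity.neg.integrableOn)
  rw [integral_sub integrable_sq_mul_gaussDensity.integrableOn
    integrable_gaussDensity.integrableOn] at h
  rw [upperTail]
  linarith

theorem setIntegral_Iic_sq (x : ℝ) :
    ∫ t in Set.Iic x, t ^ 2 * gaussDensity t = lowerTail x - x * gaussDensity x := by
  have hi := integrable_sq_mul_gaussDensity.sub integrable_gaussDensity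
  have h := integral_Iic_of_hasDerivAt_of_tendsto' (a := x)
    (fun t _ => hasDerivAt_neg_id_mul_gaussDensity t) hi.integrableOn
    (tendsto_zero_of_hasDerivAt_of_integrableOn_Iic (a := x)
      (fun t _ => hasDerivAt_neg_id_mul_gaussDensity t)
      hi.integrableOn integrable_id_mul_gaussDensity.neg.integrableOn)
  rw [integral_sub integrable_sq_mul_gaussDensity.integrableOn
    integrable_gaussDensity.integrableOn] at h
  rw [lowerTail]
  linarith

theorem integrable_sub_mul_gaussDensity (x : ℝ) :
    Integrable fun t => (t - x) * gaussDensity t := by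
  refine (integrable_id_mul_gaussDensity.sub (integrable_gaussDensity.const_mul x)).congr
    (ae_of_all _ fun t => ?_)
  simp only [Pi.sub_apply]
  ring

/-- Expanding the second moment about `x`, in the form needed for both tails. -/
theorem setIntegral_sub_sq (x : ℝ) (s : Set ℝ) :
    ∫ t in s, (t - x) ^ 2 * gaussDensity t = (∫ t in s, t ^ 2 * gaussDensity t) -
      2 * x * (∫ t in s, t * gaussDensity t) + x ^ 2 * ∫ t in s, gaussDensity t := by
  rw [← integral_const_mul, ← integral_const_mul, ← integral_sub, ← integral_add]
  · exact integral_congr_ae (ae_of_all _ fun t => by simp only; ring)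
  · exact (integrable_sq_mul_gaussDensity.integrableOn).sub
      (integrable_id_mul_gaussDensity.integrableOn.const_mul _)
  · exact integrable_gaussDensity.integrableOn.const_mul _
  · exact integrable_sq_mul_gaussDensity.integrableOn
  · exact integrable_id_mul_gaussDensity.integrableOn.const_mul _

theorem setIntegral_sub (x : ℝ) (s : Set ℝ) :
    ∫ t in s, (t - x) * gaussDensity t =
      (∫ t in s, t * gaussDensity t) - x * ∫ t in s, gaussDensity t := by
  rw [← integral_const_mul, ← integral_sub]
  · exact integral_congr_ae (ae_of_all _ fun t => by simp only; ring)
  · exact integrable_id_mul_gaussDensity.integrableOn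
  · exact integrable_gaussDensity.integrableOn.const_mul _

/-- Mills' inequality for the upper tail. -/
theorem mills_upperTail (x : ℝ) : 0 ≤ (1 + x ^ 2) * upperTail x - x * gaussDensity x := by
  have h := setIntegral_sub_sq x (Set.Ioi x)
  rw [setIntegral_Ioi_sq, setIntegral_Ioi_id, ← upperTail] at h
  have h2 : 0 ≤ ∫ t in Set.Ioi x, (t - x) ^ 2 * gaussDensity t :=
    integral_nonneg fun t => mul_nonneg (sq_nonneg _) (gaussDensity_pos t).le
  linarith

/-- Mills' inequality for the lower tail. -/
theorem mills_lowerTail (x : ℝ) : 0 ≤ (1 + x ^ 2) * lowerTail x + x * gaussDensity x := by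
  have h := setIntegral_sub_sq x (Set.Iic x)
  rw [setIntegral_Iic_sq, setIntegral_Iic_id, ← lowerTail] at h
  have h2 : 0 ≤ ∫ t in Set.Iic x, (t - x) ^ 2 * gaussDensity t :=
    integral_nonneg fun t => mul_nonneg (sq_nonneg _) (gaussDensity_pos t).le
  linarith

section Lipschitz

variable {h : ℝ → ℝ}

theorem abs_sub_le_of_lipschitz (hh : LipschitzWith 1 h) (s t : ℝ) : |h s - h t| ≤ |s - t| := by
  simpa [Real.dist_eq] using hh.dist_le_mul s t

theorem integrable_sub_const_mul_gaussDensity (hh : LipschitzWith 1 h) (c : ℝ) :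
    Integrable fun t => (h t - c) * gaussDensity t := by
  have hdom : Integrable fun t => |t * gaussDensity t| + |h 0 - c| * gaussDensity t :=
    integrable_id_mul_gaussDensity.abs.add (integrable_gaussDensity.const_mul _)
  refine hdom.mono' ((hh.continuous.sub continuous_const).mul
    continuous_gaussDensity).aestronglyMeasurable (ae_of_all _ fun t => ?_)
  rw [Real.norm_eq_abs, abs_mul, abs_mul, abs_of_pos (gaussDensity_pos t), ← add_mul]
  refine mul_le_mul_of_nonneg_right ?_ (gaussDensity_pos t).le
  have h1 := abs_sub_le_of_lipschitz hh t 0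
  rw [sub_zero] at h1
  calc |h t - c| = |(h t - h 0) + (h 0 - c)| := by ring_nf
    _ ≤ _ := (abs_add_le _ _).trans (by linarith)

theorem integral_gaussianReal_eq (g : ℝ → ℝ) :
    ∫ t, g t ∂(gaussianReal 0 1) = ∫ t, g t * gaussDensity t := by
  rw [integral_gaussianReal_eq_integral_smul one_ne_zero]
  exact integral_congr_ae (ae_of_all _ fun t => by simp [gaussDensity, mul_comm])

theorem abs_integral_Iic_le (hh : LipschitzWith 1 h) (x : ℝ) :
    |∫ t in Set.Iic x, (h t - h x) * gaussDensity t| ≤ x * lowerTail x + gaussDensity x := by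
  have h1 : x * lowerTail x + gaussDensity x =
      ∫ t in Set.Iic x, -((t - x) * gaussDensity t) := by
    rw [integral_neg, setIntegral_sub, setIntegral_Iic_id, ← lowerTail]; ring
  rw [h1]
  refine (abs_integral_le_integral_abs).trans (setIntegral_mono_on
    (integrable_sub_const_mul_gaussDensity hh _).abs.integrableOn
    (integrable_sub_mul_gaussDensity x).neg.integrableOn measurableSet_Iic fun t ht => ?_)
  rw [abs_mul, abs_of_pos (gaussDensity_pos t), ← neg_mul]
  refine mul_le_mul_of_nonneg_right ?_ (gaussDensity_pos t).le
  rw [← abs_of_nonpos (sub_nonpos.2 ht)]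
  exact abs_sub_le_of_lipschitz hh t x

theorem abs_integral_Ioi_le (hh : LipschitzWith 1 h) (x : ℝ) :
    |∫ t in Set.Ioi x, (h t - h x) * gaussDensity t| ≤ gaussDensity x - x * upperTail x := by
  have h1 : gaussDensity x - x * upperTail x = ∫ t in Set.Ioi x, (t - x) * gaussDensity t := by
    rw [setIntegral_sub, setIntegral_Ioi_id, ← upperTail]
  rw [h1]
  refine (abs_integral_le_integral_abs).trans (setIntegral_mono_on
    (integrable_sub_const_mul_gaussDensity hh _).abs.integrableOn
    (integrable_sub_mul_gaussDensity x).integrableOn measurableSet_Ioi fun t ht => ?_)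
  rw [abs_mul, abs_of_pos (gaussDensity_pos t)]
  refine mul_le_mul_of_nonneg_right ?_ (gaussDensity_pos t).le
  rw [← abs_of_pos (sub_pos.2 (Set.mem_Ioi.1 ht))]
  exact abs_sub_le_of_lipschitz hh t x

theorem hasDerivAt_integral_Iic {g : ℝ → ℝ} (hg : Integrable g) (hc : Continuous g) (x : ℝ) :
    HasDerivAt (fun x => ∫ t in Set.Iic x, g t) (g x) x := by
  have h1 : (fun x => ∫ t in Set.Iic x, g t) =
      fun x => (∫ t in Set.Iic 0, g t) + ∫ t in (0 : ℝ)..x, g t := by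
    ext x
    rw [← intervalIntegral.integral_Iic_sub_Iic hg.integrableOn hg.integrableOn]
    ring
  rw [h1]
  exact (hc.integral_hasStrictDerivAt 0 x).hasDerivAt.const_add _

/-- The bounded solution of Stein's equation for the test function `h`. -/
noncomputable def steinSol (h : ℝ → ℝ) (x : ℝ) : ℝ :=
  (∫ t in Set.Iic x, (h t - ∫ y, h y ∂(gaussianReal 0 1)) * gaussDensity t) / gaussDensity x

theorem hasDerivAt_steinSol (hh : LipschitzWith 1 h) (x : ℝ) :
    HasDerivAt (steinSol h) (h x - (∫ y, h y ∂(gaussianReal 0 1)) + x * steinSol h x) x := by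
  have h1 := hasDerivAt_integral_Iic
    (integrable_sub_const_mul_gaussDensity hh (∫ y, h y ∂(gaussianReal 0 1)))
    ((hh.continuous.sub continuous_const).mul continuous_gaussDensity) x
  have hne := (gaussDensity_pos x).ne'
  refine (h1.div (hasDerivAt_gaussDensity x) hne).congr_deriv ?_
  simp only [steinSol]
  field_simp
  ring

/-- The integrals over the two half-lines determine both `h x` minus the Gaussian mean of `h` and the
value of the Stein solution at `x`. -/
theorem steinSol_decomp (hh : LipschitzWith 1 h) (x : ℝ) :
    ∃ a b : ℝ, |a| ≤ x * lowerTail x + gaussDensity x ∧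
      |b| ≤ gaussDensity x - x * upperTail x ∧
      h x - (∫ y, h y ∂(gaussianReal 0 1)) = -(a + b) ∧
      steinSol h x * gaussDensity x = a * upperTail x - b * lowerTail x := by
  set m := ∫ y, h y ∂(gaussianReal 0 1) with hm
  have hmean : m - h x = (∫ t in Set.Iic x, (h t - h x) * gaussDensity t) +
      ∫ t in Set.Ioi x, (h t - h x) * gaussDensity t := by
    rw [setIntegral_Iic_add_Ioi (integrable_sub_const_mul_gaussDensity hh _)]
    have h1 : ∫ t, (h t - h x) * gaussDensity t =
        (∫ t, (h t - 0) * gaussDensity t) - ∫ t, h x * gaussDensity t := by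
      rw [← integral_sub (integrable_sub_const_mul_gaussDensity hh 0)
        (integrable_gaussDensity.const_mul _)]
      exact integral_congr_ae (ae_of_all _ fun t => by simp only; ring)
    rw [h1, integral_const_mul, integral_gaussDensity, hm, integral_gaussianReal_eq]
    simp
  refine ⟨_, _, abs_integral_Iic_le hh x, abs_integral_Ioi_le hh x, ?_, ?_⟩
  · rw [← hmean]
    ring
  · have h2 : ∫ t in Set.Iic x, (h t - m) * gaussDensity t =
        (∫ t in Set.Iic x, (h t - h x) * gaussDensity t) - (m - h x) * lowerTail x := by
      rw [lowerTail, ← integral_const_mul,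
        ← integral_sub (integrable_sub_const_mul_gaussDensity hh _).integrableOn
        (integrable_gaussDensity.integrableOn.const_mul _)]
      exact integral_congr_ae (ae_of_all _ fun t => by simp only; ring)
    rw [steinSol, ← hm, div_mul_cancel₀ _ (gaussDensity_pos x).ne', h2, hmean]
    have := lowerTail_add_upperTail x
    rw [show upperTail x = 1 - lowerTail x by linarith]
    ring

theorem abs_deriv_steinSol_le (hh : LipschitzWith 1 h) (x : ℝ) :
    |h x - (∫ y, h y ∂(gaussianReal 0 1)) + x * steinSol h x| ≤ 3 / 2 := by
  obtain ⟨a, b, ha, hb, h1, h2⟩ := steinSol_decomp hh x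
  have hφ := gaussDensity_pos x
  have hφ2 := gaussDensity_le x
  have hsum := lowerTail_add_upperTail x
  have hM1 := mills_upperTail x
  have hM2 := mills_lowerTail x
  have hΦ : 0 ≤ lowerTail x := integral_nonneg fun t => (gaussDensity_pos t).le
  have hΨ : 0 ≤ upperTail x := integral_nonneg fun t => (gaussDensity_pos t).le
  set α := x * lowerTail x + gaussDensity x with hα
  set β := gaussDensity x - x * upperTail x with hβ
  have hα0 : 0 ≤ α := (abs_nonneg _).trans ha
  have hβ0 : 0 ≤ β := (abs_nonneg _).trans hb
  have hdiff : α - β = x := by rw [hα, hβ]; linear_combination x * hsum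
  have hkey : (h x - (∫ y, h y ∂(gaussianReal 0 1)) + x * steinSol h x) * gaussDensity x =
      -(a * β) - b * α := by
    rw [h1, add_mul, mul_assoc, h2, hα, hβ]
    ring
  have hx2 : 0 < 1 + x ^ 2 := by positivity
  have hprod : α * β ≤ 3 / 4 * gaussDensity x := by
    rcases le_total 0 x with hx | hx
    · have h3 : β * (1 + x ^ 2) ≤ gaussDensity x := by rw [hβ]; nlinarith
      have h4 : α ≤ x + 2 / 5 := by nlinarith
      have h5 : α * (β * (1 + x ^ 2)) ≤ (x + 2 / 5) * gaussDensity x :=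
        mul_le_mul h4 h3 (by positivity) (by linarith)
      have h6 : x + 2 / 5 ≤ 3 / 4 * (1 + x ^ 2) := by nlinarith [sq_nonneg (x - 2 / 3)]
      have h7 := mul_le_mul_of_nonneg_right h6 hφ.le
      have h8 : α * β * (1 + x ^ 2) ≤ 3 / 4 * gaussDensity x * (1 + x ^ 2) := by linarith
      exact le_of_mul_le_mul_right h8 hx2
    · have h3 : α * (1 + x ^ 2) ≤ gaussDensity x := by rw [hα]; nlinarith
      have h4 : β ≤ -x + 2 / 5 := by nlinarith
      have h5 : β * (α * (1 + x ^ 2)) ≤ (-x + 2 / 5) * gaussDensity x :=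
        mul_le_mul h4 h3 (by positivity) (by linarith)
      have h6 : -x + 2 / 5 ≤ 3 / 4 * (1 + x ^ 2) := by nlinarith [sq_nonneg (x + 2 / 3)]
      have h7 := mul_le_mul_of_nonneg_right h6 hφ.le
      have h8 : α * β * (1 + x ^ 2) ≤ 3 / 4 * gaussDensity x * (1 + x ^ 2) := by linarith
      exact le_of_mul_le_mul_right h8 hx2
  refine le_of_mul_le_mul_right ?_ hφ
  rw [← abs_of_pos hφ, ← abs_mul, abs_of_pos hφ, hkey]
  calc |-(a * β) - b * α| ≤ |-(a * β)| + |b * α| := abs_sub _ _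
    _ = |a| * β + |b| * α := by rw [abs_neg, abs_mul, abs_mul, abs_of_nonneg hα0, abs_of_nonneg hβ0]
    _ ≤ α * β + β * α := add_le_add (mul_le_mul_of_nonneg_right ha hβ0)
        (mul_le_mul_of_nonneg_right hb hα0)
    _ ≤ _ := by linarith

/-- The derivative of `x * steinSol h x` is bounded by `1`; the bound on the right is an exact
identity between the Gaussian tails. -/
theorem abs_deriv_mul_steinSol_le (hh : LipschitzWith 1 h) (x : ℝ) :
    |steinSol h x + x * (h x - (∫ y, h y ∂(gaussianReal 0 1)) + x * steinSol h x)| ≤ 1 := by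
  obtain ⟨a, b, ha, hb, h1, h2⟩ := steinSol_decomp hh x
  have hφ := gaussDensity_pos x
  have hsum := lowerTail_add_upperTail x
  have hM1 := mills_upperTail x
  have hM2 := mills_lowerTail x
  have hkey : (steinSol h x + x * (h x - (∫ y, h y ∂(gaussianReal 0 1)) + x * steinSol h x)) *
      gaussDensity x = a * ((1 + x ^ 2) * upperTail x - x * gaussDensity x) -
        b * ((1 + x ^ 2) * lowerTail x + x * gaussDensity x) := by
    rw [h1]
    linear_combination (1 + x ^ 2) * h2
  refine le_of_mul_le_mul_right ?_ hφ
  rw [← abs_of_pos hφ, ← abs_mul, abs_of_pos hφ, hkey]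
  refine (abs_sub _ _).trans ?_
  rw [abs_mul, abs_mul, abs_of_nonneg hM1, abs_of_nonneg hM2]
  refine (add_le_add (mul_le_mul_of_nonneg_right ha hM1)
    (mul_le_mul_of_nonneg_right hb hM2)).trans_eq ?_
  linear_combination gaussDensity x * hsum

theorem lipschitz_deriv_steinSol (hh : LipschitzWith 1 h) (x y : ℝ) :
    |(h x - (∫ y, h y ∂(gaussianReal 0 1)) + x * steinSol h x) -
      (h y - (∫ y, h y ∂(gaussianReal 0 1)) + y * steinSol h y)| ≤ 2 * |x - y| := by
  have hd : ∀ z ∈ (Set.univ : Set ℝ), HasDerivWithinAt (fun z => z * steinSol h z)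
      (steinSol h z + z * (h z - (∫ y, h y ∂(gaussianReal 0 1)) + z * steinSol h z)) Set.univ z := by
    intro z _
    exact (((hasDerivAt_id' z).mul (hasDerivAt_steinSol hh z)).congr_deriv
      (by ring)).hasDerivWithinAt
  have h1 := Convex.norm_image_sub_le_of_norm_hasDerivWithin_le (C := 1) hd
    (fun z _ => abs_deriv_mul_steinSol_le hh z) convex_univ (Set.mem_univ y) (Set.mem_univ x)
  rw [Real.norm_eq_abs, Real.norm_eq_abs, one_mul] at h1
  have h2 := abs_sub_le_of_lipschitz hh x y
  calc _ = |(h x - h y) + (x * steinSol h x - y * steinSol h y)| := by ring_nf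
    _ ≤ |h x - h y| + |x * steinSol h x - y * steinSol h y| := abs_add_le _ _
    _ ≤ _ := by linarith

end Lipschitz

/-- Stein's equation for a `1`-Lipschitz function has a solution with bounded and Lipschitz
derivative. -/
theorem exists_stein_solution {h : ℝ → ℝ} (hh : LipschitzWith 1 h) :
    ∃ f f' : ℝ → ℝ, (∀ x, HasDerivAt f (f' x) x) ∧
      (∀ x, h x - (∫ y, h y ∂(gaussianReal 0 1)) = f' x - x * f x) ∧
      (∀ x, |f' x| ≤ 3 / 2) ∧ ∀ x y, |f' x - f' y| ≤ 2 * |x - y| :=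
  ⟨steinSol h, fun x => h x - (∫ y, h y ∂(gaussianReal 0 1)) + x * steinSol h x,
    hasDerivAt_steinSol hh, fun x => by ring, abs_deriv_steinSol_le hh,
    lipschitz_deriv_steinSol hh⟩

/-! ### Normal approximation under local dependence -/

theorem abs_taylor_le {f f' : ℝ → ℝ} (hf : ∀ x, HasDerivAt f (f' x) x)
    (hlip : ∀ x y, |f' x - f' y| ≤ 2 * |x - y|) (x y : ℝ) :
    |f x - f y - f' x * (x - y)| ≤ (x - y) ^ 2 := by
  -- Cauchy's mean value theorem for `f z - f' x * z` and `(z - x) ^ 2`.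
  have hF : ∀ z, HasDerivAt (fun z => f z - f' x * z) (f' z - f' x) z := fun z =>
    ((hf z).sub ((hasDerivAt_id' z).const_mul (f' x))).congr_deriv (by ring)
  have hG : ∀ z, HasDerivAt (fun z => (z - x) ^ 2) (2 * (z - x)) z := fun z =>
    (((hasDerivAt_id' z).sub_const x).pow 2).congr_deriv (by ring)
  have key : ∀ a b, a < b → (∀ c ∈ Set.Ioo a b, c ≠ x) →
      |(f b - f' x * b) - (f a - f' x * a)| ≤ |(b - x) ^ 2 - (a - x) ^ 2| := by
    intro a b hab hne
    obtain ⟨c, hc, hcc⟩ := exists_ratio_hasDerivAt_eq_ratio_slope _ _ hab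
      (fun z _ => (hF z).continuousAt.continuousWithinAt) (fun z _ => hF z) _ _
      (fun z _ => (hG z).continuousAt.continuousWithinAt) (fun z _ => hG z)
    have hcx : 0 < 2 * |c - x| := by
      have := abs_pos.2 (sub_ne_zero.2 (hne c hc)); linarith
    have h1 := congrArg abs hcc
    rw [abs_mul, abs_mul, abs_mul 2, abs_two] at h1
    have h2 := mul_le_mul_of_nonneg_left (hlip c x) (abs_nonneg ((b - x) ^ 2 - (a - x) ^ 2))
    rw [h1] at h2
    exact le_of_mul_le_mul_right h2 hcx
  rcases lt_trichotomy x y with h | rfl | h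
  · have := key x y h (fun c hc => hc.1.ne')
    rw [sub_self, zero_pow two_ne_zero, sub_zero, abs_of_nonneg (sq_nonneg (y - x))] at this
    rw [← abs_neg]
    calc _ = _ := by congr 1; ring
      _ ≤ _ := this
      _ = _ := by ring
  · simp
  · have := key y x h (fun c hc => hc.2.ne)
    rw [sub_self, zero_pow two_ne_zero, zero_sub, abs_neg, abs_of_nonneg (sq_nonneg (y - x))] at this
    calc _ = _ := by congr 1; ring
      _ ≤ _ := this
      _ = _ := by ring

section LocalDependence

variable {Ω : Type*} [MeasurableSpace Ω]

/-- A sequence of random variables is `k`-dependent if expectations factor for functions of two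
families of variables whose indices differ by more than `k`. -/
def KDependent (k : ℕ) (X : ℕ → Ω → ℝ) (P : Measure Ω) : Prop :=
  ∀ S T : Set ℕ, (∀ i ∈ S, ∀ j ∈ T, i + k < j ∨ j + k < i) →
    ∀ F G : (ℕ → ℝ) → ℝ, DependsOn F S → DependsOn G T →
      ∫ ω, F (fun i => X i ω) * G (fun i => X i ω) ∂P =
        (∫ ω, F (fun i => X i ω) ∂P) * ∫ ω, G (fun i => X i ω) ∂P

/-- The indices below `N` at distance at most `k` from `i`. -/
def nbhd (k N i : ℕ) : Finset ℕ := (Finset.range N).filter fun j => j ≤ i + k ∧ i ≤ j + k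

theorem dependsOn_sum (s : Finset ℕ) : DependsOn (fun x : ℕ → ℝ => ∑ i ∈ s, x i) s :=
  fun _ _ h => Finset.sum_congr rfl fun i hi => h i hi

theorem KDependent.integral_mul_far {P : Measure Ω} {k N : ℕ} {X : ℕ → Ω → ℝ}
    (hX : KDependent k X P) {i : ℕ} (h0 : ∫ ω, X i ω ∂P = 0) (g : ℝ → ℝ) :
    ∫ ω, X i ω * g (∑ j ∈ Finset.range N, X j ω - ∑ j ∈ nbhd k N i, X j ω) ∂P = 0 := by
  have hsum : ∀ x : ℕ → ℝ, ∑ j ∈ Finset.range N, x j - ∑ j ∈ nbhd k N i, x j =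
      ∑ j ∈ (Finset.range N).filter fun j => ¬ (j ≤ i + k ∧ i ≤ j + k), x j := by
    intro x
    rw [nbhd, sub_eq_iff_eq_add, add_comm, Finset.sum_filter_add_sum_filter_not]
  have h := hX {i} ((Finset.range N).filter fun j => ¬ (j ≤ i + k ∧ i ≤ j + k) : Finset ℕ)
    (by
      intro a ha b hb
      rw [Set.mem_singleton_iff] at ha
      simp only [Finset.coe_filter, Set.mem_ofPred_eq] at hb
      omega)
    (fun x => x i) (fun x => g (∑ j ∈ (Finset.range N).filter
      fun j => ¬ (j ≤ i + k ∧ i ≤ j + k), x j))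
    (fun x y hxy => hxy i rfl) (fun x y hxy => congrArg g (dependsOn_sum _ hxy))
  simp only [hsum]
  rw [h, h0, zero_mul]

variable [Finite Ω] [MeasurableSingletonClass Ω]

theorem sq_integral_abs_le {P : Measure Ω} [IsProbabilityMeasure P] (g : Ω → ℝ) :
    (∫ ω, |g ω| ∂P) ^ 2 ≤ ∫ ω, g ω ^ 2 ∂P := by
  have h := variance_nonneg (fun ω => |g ω|) P
  rw [variance_eq_sub (MemLp.of_discrete)] at h
  simpa using h

theorem integral_sum_fin {P : Measure Ω} [IsFiniteMeasure P] {ι : Type*} (s : Finset ι)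
    (F : ι → Ω → ℝ) : ∫ ω, ∑ i ∈ s, F i ω ∂P = ∑ i ∈ s, ∫ ω, F i ω ∂P :=
  integral_finsetSum s fun _ _ => Integrable.of_finite

variable {P : Measure Ω} [IsProbabilityMeasure P] {k N : ℕ} {X : ℕ → Ω → ℝ}

theorem KDependent.integral_mul_nbhd (hX : KDependent k X P) {i : ℕ}
    (h0 : ∫ ω, X i ω ∂P = 0) :
    ∫ ω, X i ω * ∑ j ∈ nbhd k N i, X j ω ∂P = ∫ ω, X i ω * ∑ j ∈ Finset.range N, X j ω ∂P := by
  have h := hX.integral_mul_far (N := N) h0 id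
  simp only [id, mul_sub] at h
  rw [integral_sub Integrable.of_finite Integrable.of_finite] at h
  linarith

theorem integral_mul_sub_le (U V : Ω → ℝ) {B : ℝ} (hU : ∫ ω, U ω ^ 2 ∂P ≤ B)
    (hV : ∫ ω, V ω ^ 2 ∂P ≤ B) :
    ∫ ω, U ω * V ω ∂P - (∫ ω, U ω ∂P) * ∫ ω, V ω ∂P ≤ B := by
  set u := ∫ ω, U ω ∂P
  set v := ∫ ω, V ω ∂P
  have h : 0 ≤ ∫ ω, ((U ω - u) - (V ω - v)) ^ 2 ∂P := integral_nonneg fun _ => sq_nonneg _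
  have h2 : ∫ ω, ((U ω - u) - (V ω - v)) ^ 2 ∂P =
      (∫ ω, U ω ^ 2 ∂P) + (∫ ω, V ω ^ 2 ∂P) - 2 * (∫ ω, U ω * V ω ∂P) - (u - v) ^ 2 := by
    have : ∀ ω, ((U ω - u) - (V ω - v)) ^ 2 = U ω ^ 2 + V ω ^ 2 - 2 * (U ω * V ω) -
        2 * (u - v) * (U ω - V ω) + (u - v) ^ 2 := fun ω => by ring
    simp only [this]
    rw [integral_add Integrable.of_finite Integrable.of_finite,
      integral_sub Integrable.of_finite Integrable.of_finite,
      integral_sub Integrable.of_finite Integrable.of_finite,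
      integral_add Integrable.of_finite Integrable.of_finite, integral_const_mul,
      integral_const_mul, integral_sub Integrable.of_finite Integrable.of_finite]
    simp only [integral_const, probReal_univ, one_smul]
    ring
  nlinarith [sq_nonneg u, sq_nonneg v, sq_nonneg (u - v), sq_nonneg (u + v)]

/-- The products `X i * ∑ X j` over neighbourhoods are `3 * k`-dependent, which bounds the variance
of their sum. -/
theorem KDependent.integral_sq_sum_mul_nbhd_le (hX : KDependent k X P)
    (hb : ∀ i ω, |X i ω| ≤ 1) {B c : ℝ} (hB : ∀ i < N, ∫ ω, (∑ j ∈ nbhd k N i, X j ω) ^ 2 ∂P ≤ B)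
    (hB0 : 0 ≤ B)
    (hc : c = ∑ i ∈ Finset.range N, ∫ ω, X i ω * ∑ j ∈ nbhd k N i, X j ω ∂P) :
    ∫ ω, (c - ∑ i ∈ Finset.range N, X i ω * ∑ j ∈ nbhd k N i, X j ω) ^ 2 ∂P ≤
      (6 * k + 1) * N * B := by
  set U : ℕ → Ω → ℝ := fun i ω => X i ω * ∑ j ∈ nbhd k N i, X j ω with hU
  have hU2 : ∀ i < N, ∫ ω, U i ω ^ 2 ∂P ≤ B := by
    intro i hi
    refine le_trans (integral_mono Integrable.of_finite Integrable.of_finite fun ω => ?_) (hB i hi)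
    simp only [hU, mul_pow]
    have : X i ω ^ 2 ≤ 1 := by rw [sq_le_one_iff_abs_le_one]; exact hb i ω
    exact mul_le_of_le_one_left (sq_nonneg _) this
  have hexp : ∫ ω, (c - ∑ i ∈ Finset.range N, U i ω) ^ 2 ∂P =
      ∑ i ∈ Finset.range N, ∑ j ∈ Finset.range N,
        (∫ ω, U i ω * U j ω ∂P - (∫ ω, U i ω ∂P) * ∫ ω, U j ω ∂P) := by
    have h1 : ∀ ω, (c - ∑ i ∈ Finset.range N, U i ω) ^ 2 =
        (∑ i ∈ Finset.range N, ∑ j ∈ Finset.range N, U i ω * U j ω) -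
          2 * c * (∑ i ∈ Finset.range N, U i ω) + c ^ 2 := by
      intro ω
      rw [← Finset.sum_mul_sum]
      ring
    simp only [h1]
    rw [integral_add Integrable.of_finite Integrable.of_finite,
      integral_sub Integrable.of_finite Integrable.of_finite, integral_const_mul,
      integral_sum_fin, integral_sum_fin]
    simp only [integral_sum_fin, Finset.sum_sub_distrib]
    rw [← Finset.sum_mul_sum, ← hc]
    simp only [integral_const, probReal_univ, one_smul]
    ring
  change ∫ ω, (c - ∑ i ∈ Finset.range N, U i ω) ^ 2 ∂P ≤ _
  rw [hexp]
  have hterm : ∀ i ∈ Finset.range N, ∑ j ∈ Finset.range N,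
      (∫ ω, U i ω * U j ω ∂P - (∫ ω, U i ω ∂P) * ∫ ω, U j ω ∂P) ≤ (6 * k + 1) * B := by
    intro i hi
    have hiN := Finset.mem_range.1 hi
    have h1 : ∑ j ∈ Finset.range N,
        (∫ ω, U i ω * U j ω ∂P - (∫ ω, U i ω ∂P) * ∫ ω, U j ω ∂P) ≤
        ∑ j ∈ Finset.range N, if j ∈ Finset.Icc (i - 3 * k) (i + 3 * k) then B else 0 := by
      refine Finset.sum_le_sum fun j hj => ?_
      split_ifs with hij
      · exact integral_mul_sub_le _ _ (hU2 i hiN) (hU2 j (Finset.mem_range.1 hj))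
      · rw [Finset.mem_Icc] at hij
        have hdep : ∀ i, DependsOn (fun x : ℕ → ℝ => x i * ∑ j ∈ nbhd k N i, x j)
            {j | j ≤ i + k ∧ i ≤ j + k} := by
          intro i x y hxy
          have h2 : x i = y i := hxy i ⟨by omega, by omega⟩
          have h3 : ∑ j ∈ nbhd k N i, x j = ∑ j ∈ nbhd k N i, y j :=
            Finset.sum_congr rfl fun j hj => hxy j (Finset.mem_filter.1 hj).2
          simp only [h2, h3]
        have h2 := hX _ _ (by
          intro a ha b hb
          simp only [Set.mem_ofPred_eq] at ha hb
          omega) _ _ (hdep i) (hdep j)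
        exact (sub_eq_zero.2 h2).le
    refine h1.trans ?_
    rw [← Finset.sum_filter, Finset.sum_const, nsmul_eq_mul]
    refine mul_le_mul_of_nonneg_right ?_ hB0
    have h2 : ((Finset.range N).filter fun j => j ∈ Finset.Icc (i - 3 * k) (i + 3 * k)).card ≤
        (Finset.Icc (i - 3 * k) (i + 3 * k)).card :=
      Finset.card_le_card fun j hj => (Finset.mem_filter.1 hj).2
    rw [Nat.card_Icc] at h2
    have h3 : ((Finset.range N).filter fun j => j ∈ Finset.Icc (i - 3 * k) (i + 3 * k)).card ≤
        6 * k + 1 := by omega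
    exact_mod_cast h3
  refine (Finset.sum_le_sum hterm).trans_eq ?_
  rw [Finset.sum_const, Finset.card_range, nsmul_eq_mul]
  ring

/-- Normal approximation, in Wasserstein distance, for the sum of bounded `k`-dependent centred
random variables. -/
theorem KDependent.abs_integral_sub_le (hX : KDependent k X P) (h0 : ∀ i < N,
    ∫ ω, X i ω ∂P = 0)
    (hb : ∀ i ω, |X i ω| ≤ 1) {B σ : ℝ}
    (hB : ∀ i < N, ∫ ω, (∑ j ∈ nbhd k N i, X j ω) ^ 2 ∂P ≤ B) (hB0 : 0 ≤ B) (hσ : 0 < σ)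
    (hσ2 : ∫ ω, (∑ i ∈ Finset.range N, X i ω) ^ 2 ∂P = σ ^ 2)
    {h : ℝ → ℝ} (hh : LipschitzWith 1 h) :
    |(∫ ω, h ((∑ i ∈ Finset.range N, X i ω) / σ) ∂P) - ∫ y, h y ∂(gaussianReal 0 1)| ≤
      N * B / σ ^ 3 + 3 / 2 * (Real.sqrt ((6 * k + 1) * N * B) / σ ^ 2) := by
  obtain ⟨f, f', hf, hstein, hf', hlip⟩ := exists_stein_solution hh
  set W : Ω → ℝ := fun ω => (∑ i ∈ Finset.range N, X i ω) / σ with hW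
  set S : ℕ → Ω → ℝ := fun i ω => ∑ j ∈ nbhd k N i, X j ω with hS
  set Q : Ω → ℝ := fun ω => ∑ i ∈ Finset.range N, X i ω * S i ω with hQ
  set R : ℕ → Ω → ℝ := fun i ω => f (W ω) - f (W ω - S i ω / σ) - f' (W ω) * (S i ω / σ) with hR
  have hσ' := hσ.ne'
  have hRle : ∀ i ω, |R i ω| ≤ S i ω ^ 2 / σ ^ 2 := by
    intro i ω
    have := abs_taylor_le hf hlip (W ω) (W ω - S i ω / σ)
    rwa [sub_sub_cancel, div_pow] at this
  have hfar : ∀ i < N, ∫ ω, X i ω * f (W ω - S i ω / σ) ∂P = 0 := by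
    intro i hi
    have := hX.integral_mul_far (N := N) (h0 i hi) (fun y => f (y / σ))
    simpa only [hW, hS, sub_div] using this
  have hpt : ∀ ω, f' (W ω) - W ω * f (W ω) = f' (W ω) * (1 - Q ω / σ ^ 2) -
      (∑ i ∈ Finset.range N, X i ω * R i ω) / σ -
      (∑ i ∈ Finset.range N, X i ω * f (W ω - S i ω / σ)) / σ := by
    intro ω
    have h1 : ∑ i ∈ Finset.range N, X i ω * R i ω +
        ∑ i ∈ Finset.range N, X i ω * f (W ω - S i ω / σ) =
        (∑ i ∈ Finset.range N, X i ω) * f (W ω) - f' (W ω) * (Q ω / σ) := by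
      rw [← Finset.sum_add_distrib, Finset.sum_mul, hQ, Finset.sum_div, Finset.mul_sum,
        ← Finset.sum_sub_distrib]
      refine Finset.sum_congr rfl fun i _ => ?_
      simp only [hR]
      ring
    have h2 : W ω * f (W ω) = (∑ i ∈ Finset.range N, X i ω) * f (W ω) / σ := by
      simp only [hW]; ring
    rw [h2, sub_sub, ← add_div, h1]
    field_simp
    ring
  have hint : (∫ ω, h (W ω) ∂P) - ∫ y, h y ∂(gaussianReal 0 1) =
      (∫ ω, f' (W ω) * (1 - Q ω / σ ^ 2) ∂P) -
        (∑ i ∈ Finset.range N, ∫ ω, X i ω * R i ω ∂P) / σ := by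
    have h1 : (∫ ω, h (W ω) ∂P) - ∫ y, h y ∂(gaussianReal 0 1) =
        ∫ ω, (f' (W ω) - W ω * f (W ω)) ∂P := by
      simp only [← hstein]
      rw [integral_sub Integrable.of_finite Integrable.of_finite]
      simp
    rw [h1]
    simp only [hpt]
    rw [integral_sub Integrable.of_finite Integrable.of_finite,
      integral_sub Integrable.of_finite Integrable.of_finite, integral_div, integral_div,
      integral_sum_fin, integral_sum_fin,
      Finset.sum_eq_zero (s := Finset.range N) (f := fun i => ∫ ω, X i ω * f (W ω - S i ω / σ) ∂P)
        fun i hi => hfar i (Finset.mem_range.1 hi)]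
    ring
  have hcσ : σ ^ 2 = ∑ i ∈ Finset.range N, ∫ ω, X i ω * S i ω ∂P := by
    rw [Finset.sum_congr rfl fun i hi => hX.integral_mul_nbhd (h0 i (Finset.mem_range.1 hi)),
      ← integral_sum_fin, ← hσ2]
    refine integral_congr_ae (ae_of_all _ fun ω => ?_)
    simp only [← Finset.sum_mul]
    ring
  have hvar := hX.integral_sq_sum_mul_nbhd_le hb hB hB0 hcσ
  have hA : |∫ ω, f' (W ω) * (1 - Q ω / σ ^ 2) ∂P| ≤
      3 / 2 * (Real.sqrt ((6 * k + 1) * N * B) / σ ^ 2) := by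
    have h1 : |∫ ω, f' (W ω) * (1 - Q ω / σ ^ 2) ∂P| ≤
        ∫ ω, 3 / 2 * (|σ ^ 2 - Q ω| / σ ^ 2) ∂P := by
      refine abs_integral_le_integral_abs.trans
        (integral_mono Integrable.of_finite Integrable.of_finite fun ω => ?_)
      simp only [abs_mul]
      have h2 : |1 - Q ω / σ ^ 2| = |σ ^ 2 - Q ω| / σ ^ 2 := by
        rw [← abs_of_pos (pow_pos hσ 2), ← abs_div, abs_of_pos (pow_pos hσ 2), sub_div,
          div_self (pow_ne_zero 2 hσ')]
      rw [h2]
      exact mul_le_mul_of_nonneg_right (hf' _) (by positivity)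
    refine h1.trans ?_
    rw [integral_const_mul, integral_div]
    refine mul_le_mul_of_nonneg_left (div_le_div_of_nonneg_right ?_ (by positivity)) (by norm_num)
    exact Real.le_sqrt_of_sq_le ((sq_integral_abs_le _).trans hvar)
  have hBterm : |(∑ i ∈ Finset.range N, ∫ ω, X i ω * R i ω ∂P) / σ| ≤ N * B / σ ^ 3 := by
    rw [abs_div, abs_of_pos hσ]
    have h1 : ∀ i ∈ Finset.range N, |∫ ω, X i ω * R i ω ∂P| ≤ B / σ ^ 2 := by
      intro i hi
      calc |∫ ω, X i ω * R i ω ∂P| ≤ ∫ ω, S i ω ^ 2 / σ ^ 2 ∂P := by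
            refine abs_integral_le_integral_abs.trans
              (integral_mono Integrable.of_finite Integrable.of_finite fun ω => ?_)
            simp only [abs_mul]
            exact (mul_le_of_le_one_left (abs_nonneg _) (hb i ω)).trans (hRle i ω)
        _ ≤ B / σ ^ 2 := by
            rw [integral_div]
            exact div_le_div_of_nonneg_right (hB i (Finset.mem_range.1 hi)) (by positivity)
    have h2 := (Finset.abs_sum_le_sum_abs _ _).trans (Finset.sum_le_sum h1)
    rw [Finset.sum_const, Finset.card_range, nsmul_eq_mul] at h2
    refine (div_le_div_of_nonneg_right h2 hσ.le).trans_eq ?_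
    field_simp
  rw [hint]
  refine (abs_sub _ _).trans ?_
  linarith

end LocalDependence


/-! ### Independence and moments of the window indicators -/

theorem integral_mul_of_dependsOn {a m : ℕ} (p : PMF (Fin a)) {S T : Set (Fin m)}
    (hST : Disjoint S T) {F G : (Fin m → Fin a) → ℝ} (hF : DependsOn F S) (hG : DependsOn G T) :
    ∫ w, F w * G w ∂(wordLaw p m) = (∫ w, F w ∂(wordLaw p m)) * ∫ w, G w ∂(wordLaw p m) := by
  classical
  obtain ⟨x₀, -⟩ := p.support_nonempty
  have hind : iIndepFun (fun (i : Fin m) (w : Fin m → Fin a) => w i) (wordLaw p m) :=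
    iIndepFun_pi (μ := fun _ : Fin m => p.toMeasure) (X := fun _ x => x)
      fun _ => aemeasurable_id'
  have h1 := hind.indepFun_finset S.toFinset T.toFinset (by simpa using hST)
    fun i => measurable_pi_apply i
  have extend : ∀ {H : (Fin m → Fin a) → ℝ} {A : Set (Fin m)}, DependsOn H A →
      H = (fun y : A.toFinset → Fin a => H fun i => if h : i ∈ A.toFinset then y ⟨i, h⟩ else x₀) ∘
        fun w i => w i := by
    intro H A hH
    ext w
    refine hH fun i hi => ?_
    simp [hi]
  have h2 := h1.comp (measurable_of_finite fun y : S.toFinset → Fin a =>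
      F fun i => if h : i ∈ S.toFinset then y ⟨i, h⟩ else x₀)
    (measurable_of_finite fun y : T.toFinset → Fin a =>
      G fun i => if h : i ∈ T.toFinset then y ⟨i, h⟩ else x₀)
  rw [← extend hF, ← extend hG] at h2
  exact h2.integral_mul_eq_mul_integral (measurable_of_finite _).aestronglyMeasurable
    (measurable_of_finite _).aestronglyMeasurable

theorem dependsOn_minInd {a m : ℕ} (k s : ℕ) : DependsOn (minInd (a := a) (m := m) k s)
    {t | s ≤ (t : ℕ) ∧ (t : ℕ) ≤ s + k} := by
  intro w w' h
  unfold minInd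
  refine if_congr ?_ rfl rfl
  have h1 : ∀ r t : Fin m, (r : ℕ) = s → s < t → (t : ℕ) ≤ s + k →
      w r = w' r ∧ w t = w' t := fun r t hr hst ht =>
    ⟨h r ⟨hr.ge, by omega⟩, h t ⟨hst.le, ht⟩⟩
  constructor
  · intro H r t hr hst ht
    obtain ⟨e1, e2⟩ := h1 r t hr hst ht
    rw [← e1, ← e2]; exact H r t hr hst ht
  · intro H r t hr hst ht
    obtain ⟨e1, e2⟩ := h1 r t hr hst ht
    rw [e1, e2]; exact H r t hr hst ht

theorem kDependent_minInd {a : ℕ} (p : PMF (Fin a)) (m k : ℕ) (c : ℝ) :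
    KDependent k (fun s (w : Fin m → Fin a) => minInd k s w - c) (wordLaw p m) := by
  intro S T hST F G hF hG
  have dep : ∀ {H : (ℕ → ℝ) → ℝ} {A : Set ℕ}, DependsOn H A →
      DependsOn (fun w : Fin m → Fin a => H fun s => minInd k s w - c)
        {t | ∃ s ∈ A, s ≤ (t : ℕ) ∧ (t : ℕ) ≤ s + k} := by
    intro H A hH w w' h
    refine hH fun s hs => ?_
    rw [dependsOn_minInd k s fun t ht => h t ⟨s, hs, ht⟩]
  refine integral_mul_of_dependsOn p ?_ (dep hF) (dep hG)
  rw [Set.disjoint_left]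
  rintro t ⟨s, hs, h1⟩ ⟨s', hs', h2⟩
  rcases hST s hs s' hs' with h | h <;> omega

theorem minInd_sq {a m : ℕ} (k s : ℕ) (w : Fin m → Fin a) : minInd k s w ^ 2 = minInd k s w := by
  unfold minInd; split_ifs <;> simp

theorem minInd_nonneg {a m : ℕ} (k s : ℕ) (w : Fin m → Fin a) : 0 ≤ minInd k s w := by
  unfold minInd; split_ifs <;> simp

theorem minInd_le_one {a m : ℕ} (k s : ℕ) (w : Fin m → Fin a) : minInd k s w ≤ 1 := by
  unfold minInd; split_ifs <;> simp

/-- The probability of a letter, as a real number. -/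
noncomputable def letterProb {a : ℕ} (p : PMF (Fin a)) (x : Fin a) : ℝ := (p x).toReal

theorem sum_letterProb {a : ℕ} (p : PMF (Fin a)) : ∑ x, letterProb p x = 1 := by
  unfold letterProb
  rw [← ENNReal.toReal_sum fun x _ => p.apply_ne_top x]
  have := p.tsum_coe
  rw [tsum_fintype] at this
  rw [this, ENNReal.toReal_one]

theorem letterProb_pos {a : ℕ} {p : PMF (Fin a)} (hp : ∀ i, 0 < p i) (x : Fin a) :
    0 < letterProb p x := ENNReal.toReal_pos (hp x).ne' (p.apply_ne_top x)

/-- The probability of a cylinder set of words. -/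
theorem integral_cylinder {a : ℕ} (p : PMF (Fin a)) (m : ℕ) (A : ℕ → Finset (Fin a)) :
    ∫ w, (if ∀ t : Fin m, w t ∈ A t then 1 else 0 : ℝ) ∂(wordLaw p m) =
      ∏ t ∈ Finset.range m, ∑ x ∈ A t, letterProb p x := by
  have h1 : ∀ w : Fin m → Fin a, (if ∀ t : Fin m, w t ∈ A t then 1 else 0 : ℝ) =
      ∏ t : Fin m, if w t ∈ A t then 1 else 0 := by
    intro w
    rw [Finset.prod_boole]
    simp
  simp only [h1]
  rw [wordLaw, integral_fintype_prod_eq_prod (fun (t : Fin m) (x : Fin a) =>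
    (if x ∈ A t then 1 else 0 : ℝ)),
    ← Fin.prod_univ_eq_prod_range (fun t => ∑ x ∈ A t, letterProb p x) m]
  refine Finset.prod_congr rfl fun t _ => ?_
  rw [PMF.integral_eq_sum]
  simp [letterProb]

theorem prod_range_eq_of_eq_one {m s l : ℕ} (hm : s + l ≤ m) (c : ℕ → ℝ)
    (hc : ∀ t, t < s ∨ s + l ≤ t → c t = 1) :
    ∏ t ∈ Finset.range m, c t = ∏ i ∈ Finset.range l, c (s + i) := by
  have h1 : ∏ t ∈ Finset.Ico s (s + l), c t = ∏ t ∈ Finset.range m, c t := by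
    refine Finset.prod_subset (fun t ht => ?_) fun t _ ht => hc t ?_
    · rw [Finset.mem_Ico] at ht; rw [Finset.mem_range]; omega
    · rw [Finset.mem_Ico] at ht; omega
  rw [← h1, Finset.prod_Ico_eq_prod_range]
  simp

/-- The probability that a letter is at least `x`. -/
noncomputable def tailProb {a : ℕ} (p : PMF (Fin a)) (x : Fin a) : ℝ :=
  ∑ y ∈ Finset.Ici x, letterProb p y

theorem integral_minInd {a : ℕ} (p : PMF (Fin a)) {m k s : ℕ} (hs : s + k < m) :
    ∫ w, minInd k s w ∂(wordLaw p m) = ∑ x, letterProb p x * tailProb p x ^ k := by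
  classical
  set A : Fin a → ℕ → Finset (Fin a) := fun x t =>
    if t = s then {x} else if s < t ∧ t ≤ s + k then Finset.Ici x else Finset.univ with hA
  set r : Fin m := ⟨s, by omega⟩
  have h1 : ∀ w : Fin m → Fin a, minInd k s w =
      ∑ x, if ∀ t : Fin m, w t ∈ A x t then 1 else 0 := by
    intro w
    rw [Finset.sum_eq_single (w r)]
    · unfold minInd
      refine if_congr ?_ rfl rfl
      constructor
      · intro h t
        simp only [hA]
        split_ifs with h1 h2
        · rw [Finset.mem_singleton, show t = r from Fin.ext h1]
        · exact Finset.mem_Ici.2 (h r t rfl h2.1 h2.2)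
        · exact Finset.mem_univ _
      · intro h r' t hr hst ht
        obtain rfl : r' = r := Fin.ext hr
        have := h t
        simp only [hA] at this
        rw [if_neg (by omega), if_pos ⟨hst, ht⟩] at this
        exact Finset.mem_Ici.1 this
    · intro x _ hx
      refine if_neg fun h => hx ?_
      have := h r
      simp only [hA] at this
      rw [if_pos rfl, Finset.mem_singleton] at this
      exact this.symm
    · simp
  simp only [h1]
  rw [integral_sum_fin]
  refine Finset.sum_congr rfl fun x _ => ?_
  rw [integral_cylinder, prod_range_eq_of_eq_one (s := s) (l := k + 1) (by omega),
    Finset.prod_range_succ', mul_comm]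
  · congr 1
    · simp [hA]
    · rw [Finset.prod_congr rfl (g := fun _ => tailProb p x), Finset.prod_const,
        Finset.card_range]
      intro i hi
      rw [Finset.mem_range] at hi
      simp only [hA]
      rw [if_neg (by omega), if_pos (by omega), tailProb]
  · intro t ht
    simp only [hA]
    rw [if_neg (by omega), if_neg (by omega), sum_letterProb]

theorem integral_minInd_mul {a : ℕ} (p : PMF (Fin a)) {m k s j : ℕ} (hj : 1 ≤ j) (hjk : j ≤ k)
    (hs : s + j + k < m) :
    ∫ w, minInd k s w * minInd k (s + j) w ∂(wordLaw p m) =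
      ∑ x, letterProb p x * tailProb p x ^ (j - 1) *
        ∑ y ∈ Finset.Ici x, letterProb p y * tailProb p y ^ k := by
  classical
  set A : Fin a → Fin a → ℕ → Finset (Fin a) := fun x y t =>
    if t = s then {x} else if s < t ∧ t < s + j then Finset.Ici x else
      if t = s + j then {y} else if s + j < t ∧ t ≤ s + j + k then Finset.Ici y
      else Finset.univ with hA
  set r : Fin m := ⟨s, by omega⟩
  set r' : Fin m := ⟨s + j, by omega⟩
  have h1 : ∀ w : Fin m → Fin a, minInd k s w * minInd k (s + j) w =
      ∑ x, ∑ y ∈ Finset.Ici x, if ∀ t : Fin m, w t ∈ A x y t then 1 else 0 := by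
    intro w
    have hx : ∀ x y, (∀ t : Fin m, w t ∈ A x y t) → w r = x ∧ w r' = y := by
      intro x y h
      have h1 := h r
      have h2 := h r'
      simp only [hA, r, r'] at h1 h2
      rw [if_pos trivial, Finset.mem_singleton] at h1
      rw [if_neg (by omega), if_neg (by omega), if_pos trivial, Finset.mem_singleton] at h2
      exact ⟨h1, h2⟩
    have h2 : ∀ x, (∑ y ∈ Finset.Ici x, if ∀ t : Fin m, w t ∈ A x y t then 1 else 0 : ℝ) =
        if w r = x ∧ x ≤ w r' ∧ ∀ t : Fin m, w t ∈ A x (w r') t then 1 else 0 := by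
      intro x
      by_cases hxr : x ≤ w r'
      · rw [Finset.sum_eq_single (w r')]
        · exact if_congr ⟨fun h => ⟨(hx _ _ h).1, hxr, h⟩, fun h => h.2.2⟩ rfl rfl
        · intro y _ hy
          exact if_neg fun h => hy (hx _ _ h).2.symm
        · intro h
          exact absurd (Finset.mem_Ici.2 hxr) h
      · rw [if_neg fun h => hxr h.2.1]
        refine Finset.sum_eq_zero fun y hy => if_neg fun h => hxr ?_
        rw [(hx _ _ h).2]
        exact Finset.mem_Ici.1 hy
    simp only [h2]
    rw [Finset.sum_eq_single (w r) (fun x _ hx => if_neg fun h => hx h.1.symm) (by simp)]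
    unfold minInd
    rw [ite_zero_mul_ite_zero, mul_one]
    refine if_congr ?_ rfl rfl
    constructor
    · rintro ⟨H1, H2⟩
      refine ⟨rfl, H1 r r' rfl (by simp only [r']; omega) (by simp only [r']; omega), fun t => ?_⟩
      simp only [hA]
      split_ifs with e1 e2 e3 e4
      · rw [Finset.mem_singleton, show t = r from Fin.ext e1]
      · exact Finset.mem_Ici.2 (H1 r t rfl e2.1 (by omega))
      · rw [Finset.mem_singleton, show t = r' from Fin.ext e3]
      · exact Finset.mem_Ici.2 (H2 r' t rfl e4.1 e4.2)
      · exact Finset.mem_univ _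
    · rintro ⟨-, hle, H⟩
      have H2 : ∀ t : Fin m, s + j < t → (t : ℕ) ≤ s + j + k → w r' ≤ w t := by
        intro t ht1 ht2
        have := H t
        simp only [hA] at this
        rw [if_neg (by omega), if_neg (by omega), if_neg (by omega), if_pos ⟨ht1, ht2⟩] at this
        exact Finset.mem_Ici.1 this
      constructor
      · intro r₁ t hr hst ht
        obtain rfl : r₁ = r := Fin.ext hr
        rcases lt_trichotomy (t : ℕ) (s + j) with h | h | h
        · have := H t
          simp only [hA] at this
          rw [if_neg (by omega), if_pos ⟨hst, h⟩] at this
          exact Finset.mem_Ici.1 this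
        · rwa [show t = r' from Fin.ext h]
        · exact hle.trans (H2 t h (by omega))
      · intro r₁ t hr hst ht
        obtain rfl : r₁ = r' := Fin.ext hr
        exact H2 t hst ht
  simp only [h1]
  rw [integral_sum_fin]
  refine Finset.sum_congr rfl fun x _ => ?_
  rw [integral_sum_fin, Finset.mul_sum]
  refine Finset.sum_congr rfl fun y _ => ?_
  rw [integral_cylinder, prod_range_eq_of_eq_one (s := s) (l := j + (k + 1)) (by omega),
    Finset.prod_range_add]
  · congr 1
    · obtain ⟨i, rfl⟩ : ∃ i, j = i + 1 := ⟨j - 1, by omega⟩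
      rw [Finset.prod_range_succ', mul_comm]
      congr 1
      · simp [hA]
      · rw [Finset.prod_congr rfl (g := fun _ => tailProb p x), Finset.prod_const,
          Finset.card_range, Nat.add_sub_cancel]
        intro l hl
        rw [Finset.mem_range] at hl
        simp only [hA]
        rw [if_neg (by omega), if_pos (by omega), tailProb]
    · rw [Finset.prod_range_succ', mul_comm]
      congr 1
      · simp only [hA]
        rw [if_neg (by omega), if_neg (by omega), if_pos (by omega), Finset.sum_singleton]
      · rw [Finset.prod_congr rfl (g := fun _ => tailProb p y), Finset.prod_const,
          Finset.card_range]
        intro l hl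
        rw [Finset.mem_range] at hl
        simp only [hA]
        rw [if_neg (by omega), if_neg (by omega), if_neg (by omega), if_pos (by omega), tailProb]
  · intro t ht
    simp only [hA]
    rw [if_neg (by omega), if_neg (by omega), if_neg (by omega), if_neg (by omega),
      sum_letterProb]

/-- A function of the letters, as a sequence that runs through the letters from the largest to the
smallest one. -/
noncomputable def fromTop {a : ℕ} (g : Fin a → ℝ) (i : ℕ) : ℝ :=
  if h : i < a then g (Fin.rev ⟨i, h⟩) else 0

theorem sum_range_fromTop {a : ℕ} (g : Fin a → ℝ) :
    ∑ i ∈ Finset.range a, fromTop g i = ∑ x, g x := by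
  rw [← Fin.sum_univ_eq_sum_range, ← Equiv.sum_comp Fin.revPerm g]
  exact Finset.sum_congr rfl fun i _ => by simp [fromTop]

theorem sum_range_succ_fromTop {a : ℕ} (g : Fin a → ℝ) {i : ℕ} (hi : i < a) :
    ∑ l ∈ Finset.range (i + 1), fromTop g l = ∑ y ∈ Finset.Ici (Fin.rev ⟨i, hi⟩), g y := by
  classical
  have h1 : ∑ y ∈ Finset.Ici (Fin.rev ⟨i, hi⟩), g y =
      ∑ y, if Fin.rev ⟨i, hi⟩ ≤ y then g y else 0 := by
    rw [← Finset.sum_filter]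
    congr 1
    ext y
    simp
  rw [h1, ← sum_range_fromTop]
  have h2 : ∀ l ∈ Finset.range a, fromTop (fun y => if Fin.rev ⟨i, hi⟩ ≤ y then g y else 0) l =
      if l < i + 1 then fromTop g l else 0 := by
    intro l hl
    rw [Finset.mem_range] at hl
    simp only [fromTop, dif_pos hl, Fin.rev_le_rev, Fin.mk_le_mk, Nat.lt_succ_iff]
  rw [Finset.sum_congr rfl h2, ← Finset.sum_filter]
  congr 1
  ext l
  simp only [Finset.mem_range, Finset.mem_filter]
  omega

theorem mass_fromTop {a : ℕ} (p : PMF (Fin a)) {i : ℕ} (hi : i < a) :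
    mass (fromTop (letterProb p)) (i + 1) = tailProb p (Fin.rev ⟨i, hi⟩) :=
  sum_range_succ_fromTop _ hi

theorem mass_fromTop_self {a : ℕ} (p : PMF (Fin a)) : mass (fromTop (letterProb p)) a = 1 := by
  rw [mass, sum_range_fromTop, sum_letterProb]

theorem windowMass_fromTop {a : ℕ} (p : PMF (Fin a)) (k : ℕ) :
    windowMass (fromTop (letterProb p)) k a = ∑ x, letterProb p x * tailProb p x ^ k := by
  rw [windowMass, ← sum_range_fromTop]
  refine Finset.sum_congr rfl fun i hi => ?_
  have hi := Finset.mem_range.1 hi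
  rw [mass_fromTop p hi]
  simp only [fromTop, dif_pos hi]

theorem windowMass_fromTop_succ {a : ℕ} (p : PMF (Fin a)) (k : ℕ) {i : ℕ} (hi : i < a) :
    windowMass (fromTop (letterProb p)) k (i + 1) =
      ∑ y ∈ Finset.Ici (Fin.rev ⟨i, hi⟩), letterProb p y * tailProb p y ^ k := by
  rw [windowMass, ← sum_range_succ_fromTop _ hi]
  refine Finset.sum_congr rfl fun l hl => ?_
  have hl : l < a := by have := Finset.mem_range.1 hl; omega
  rw [mass_fromTop p hl]
  simp only [fromTop, dif_pos hl]

theorem pairMass_fromTop {a : ℕ} (p : PMF (Fin a)) (k j : ℕ) :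
    pairMass (fromTop (letterProb p)) k j a = ∑ x, letterProb p x * tailProb p x ^ (j - 1) *
        ∑ y ∈ Finset.Ici x, letterProb p y * tailProb p y ^ k := by
  rw [pairMass, ← sum_range_fromTop]
  refine Finset.sum_congr rfl fun i hi => ?_
  have hi := Finset.mem_range.1 hi
  rw [mass_fromTop p hi, windowMass_fromTop_succ p k hi]
  simp only [fromTop, dif_pos hi]

/-- The mean of a window indicator. -/
noncomputable def windowMean {a : ℕ} (p : PMF (Fin a)) (k : ℕ) : ℝ :=
  windowMass (fromTop (letterProb p)) k a

/-- The covariance of two window indicators at distance `j`. -/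
noncomputable def windowCov {a : ℕ} (p : PMF (Fin a)) (k j : ℕ) : ℝ :=
  if j = 0 then windowMean p k * (1 - windowMean p k)
  else if j ≤ k then pairMass (fromTop (letterProb p)) k j a - windowMean p k ^ 2 else 0

theorem integral_minInd_eq {a : ℕ} (p : PMF (Fin a)) {m k s : ℕ} (hs : s < m - k) :
    ∫ w, minInd k s w ∂(wordLaw p m) = windowMean p k := by
  rw [integral_minInd p (by omega), windowMean, windowMass_fromTop]

theorem integral_minInd_sub {a : ℕ} (p : PMF (Fin a)) {m k s : ℕ} (hs : s < m - k) :
    ∫ w, (minInd k s w - windowMean p k) ∂(wordLaw p m) = 0 := by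
  rw [integral_sub Integrable.of_finite Integrable.of_finite, integral_minInd_eq p hs]
  simp

theorem integral_minInd_cov {a : ℕ} (p : PMF (Fin a)) {m k s j : ℕ} (hs : s + j < m - k) :
    ∫ w, (minInd k s w - windowMean p k) * (minInd k (s + j) w - windowMean p k) ∂(wordLaw p m) =
      windowCov p k j := by
  have hprod : ∫ w, (minInd k s w - windowMean p k) * (minInd k (s + j) w - windowMean p k)
      ∂(wordLaw p m) = (∫ w, minInd k s w * minInd k (s + j) w ∂(wordLaw p m)) -
        windowMean p k ^ 2 := by
    have h1 : ∀ w : Fin m → Fin a,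
        (minInd k s w - windowMean p k) * (minInd k (s + j) w - windowMean p k) =
        minInd k s w * minInd k (s + j) w - windowMean p k * minInd k s w -
          windowMean p k * minInd k (s + j) w + windowMean p k ^ 2 := fun w => by ring
    simp only [h1]
    rw [integral_add Integrable.of_finite Integrable.of_finite,
      integral_sub Integrable.of_finite Integrable.of_finite,
      integral_sub Integrable.of_finite Integrable.of_finite, integral_const_mul,
      integral_const_mul, integral_minInd_eq p (by omega), integral_minInd_eq p hs]
    simp only [integral_const, probReal_univ, one_smul]
    ring
  rw [windowCov]
  split_ifs with h0 hk
  · subst h0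
    rw [hprod]
    simp only [add_zero, ← sq, minInd_sq]
    rw [integral_minInd_eq p (show s < m - k by omega)]
    ring
  · rw [hprod, integral_minInd_mul p (by omega) hk (by omega), pairMass_fromTop]
  · have h := kDependent_minInd p m k (windowMean p k) {s} {s + j} (by
      intro i hi i' hi'
      rw [Set.mem_singleton_iff] at hi hi'
      omega) (fun x => x s) (fun x => x (s + j)) (fun x y h => h s rfl) (fun x y h => h _ rfl)
    rw [h, integral_minInd_sub p (by omega), zero_mul]


/-! ### The variance of the number of nodes -/

theorem sum_Icc_one_eq_sum_range (k : ℕ) (f : ℕ → ℝ) :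
    ∑ j ∈ Finset.Icc 1 k, f j = ∑ i ∈ Finset.range k, f (i + 1) := by
  induction k with
  | zero => simp
  | succ k ih => rw [Finset.sum_Icc_succ_top (by omega), ih, Finset.sum_range_succ]

theorem integral_sq_block {Ω : Type*} [MeasurableSpace Ω] [Finite Ω] [MeasurableSingletonClass Ω]
    {P : Measure Ω} [IsFiniteMeasure P] {X : ℕ → Ω → ℝ} {N : ℕ} {c : ℕ → ℝ}
    (hc : ∀ i j, i + j < N → ∫ ω, X i ω * X (i + j) ω ∂P = c j) (b l : ℕ) (hb : l + b ≤ N) :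
    ∫ ω, (∑ i ∈ Finset.range b, X (l + i) ω) ^ 2 ∂P =
      b * c 0 + 2 * ∑ i ∈ Finset.range b, ((b : ℝ) - 1 - i) * c (i + 1) := by
  induction b generalizing l with
  | zero => simp
  | succ b ih =>
    have h1 : ∀ ω, (∑ i ∈ Finset.range (b + 1), X (l + i) ω) ^ 2 =
        (∑ i ∈ Finset.range b, X (l + 1 + i) ω) ^ 2 +
          2 * (∑ i ∈ Finset.range b, X l ω * X (l + (i + 1)) ω) + X l ω * X (l + 0) ω := by
      intro ω
      rw [Finset.sum_range_succ', ← Finset.mul_sum]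
      simp only [add_assoc, add_comm 1, add_zero]
      ring
    simp only [h1]
    rw [integral_add Integrable.of_finite Integrable.of_finite,
      integral_add Integrable.of_finite Integrable.of_finite, integral_const_mul,
      integral_sum_fin, ih (l + 1) (by omega), hc l 0 (by omega),
      Finset.sum_congr rfl fun i hi => hc l (i + 1) (by have := Finset.mem_range.1 hi; omega)]
    rw [Finset.sum_range_succ (n := b)]
    have h2 : ∑ i ∈ Finset.range b, (((b + 1 : ℕ) : ℝ) - 1 - i) * c (i + 1) =
        (∑ i ∈ Finset.range b, ((b : ℝ) - 1 - i) * c (i + 1)) +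
          ∑ i ∈ Finset.range b, c (i + 1) := by
      rw [← Finset.sum_add_distrib]
      exact Finset.sum_congr rfl fun i _ => by push_cast; ring
    rw [h2]
    push_cast
    ring

/-- The variance per node in the limit of large trees. -/
noncomputable def asympVar {a : ℕ} (p : PMF (Fin a)) (k : ℕ) : ℝ :=
  windowCov p k 0 + 2 * ∑ j ∈ Finset.Icc 1 k, windowCov p k j

/-- The sum `∑ j * windowCov p k j`, which governs the boundary correction to the variance. -/
noncomputable def covMoment {a : ℕ} (p : PMF (Fin a)) (k : ℕ) : ℝ :=
  ∑ j ∈ Finset.Icc 1 k, (j : ℝ) * windowCov p k j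

theorem windowCov_eq_zero {a : ℕ} (p : PMF (Fin a)) {k j : ℕ} (hj : k < j) :
    windowCov p k j = 0 := by
  rw [windowCov, if_neg (by omega), if_neg (by omega)]

theorem integral_sq_window_block {a : ℕ} (p : PMF (Fin a)) {m k l b : ℕ} (hkb : k ≤ b)
    (hb : l + b ≤ m - k) :
    ∫ w, (∑ i ∈ Finset.range b, (minInd k (l + i) w - windowMean p k)) ^ 2 ∂(wordLaw p m) =
      b * asympVar p k - 2 * covMoment p k := by
  rw [integral_sq_block (X := fun s w => minInd k s w - windowMean p k) (c := windowCov p k)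
    (fun i j h => integral_minInd_cov p h) b l hb]
  have h1 : ∑ i ∈ Finset.range b, ((b : ℝ) - 1 - i) * windowCov p k (i + 1) =
      ∑ j ∈ Finset.Icc 1 k, ((b : ℝ) - j) * windowCov p k j := by
    rw [sum_Icc_one_eq_sum_range]
    symm
    refine (Finset.sum_subset (Finset.range_subset_range.2 hkb) fun i _ hi => ?_).trans
      (Finset.sum_congr rfl fun i _ => by push_cast; ring)
    rw [Finset.mem_range] at hi
    rw [windowCov_eq_zero p (by omega), mul_zero]
  rw [h1, asympVar, covMoment]
  simp only [sub_mul, Finset.sum_sub_distrib, ← Finset.mul_sum]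
  ring

theorem tailProb_nonneg {a : ℕ} (p : PMF (Fin a)) (x : Fin a) : 0 ≤ tailProb p x :=
  Finset.sum_nonneg fun _ _ => ENNReal.toReal_nonneg

theorem tailProb_le_one {a : ℕ} (p : PMF (Fin a)) (x : Fin a) : tailProb p x ≤ 1 := by
  rw [← sum_letterProb p]
  exact Finset.sum_le_sum_of_subset_of_nonneg (Finset.subset_univ _)
    fun _ _ _ => ENNReal.toReal_nonneg

theorem windowMean_eq {a : ℕ} (p : PMF (Fin a)) (k : ℕ) :
    windowMean p k = ∑ x, letterProb p x * tailProb p x ^ k := windowMass_fromTop p k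

theorem windowMean_nonneg {a : ℕ} (p : PMF (Fin a)) (k : ℕ) : 0 ≤ windowMean p k := by
  rw [windowMean_eq]
  exact Finset.sum_nonneg fun x _ =>
    mul_nonneg ENNReal.toReal_nonneg (pow_nonneg (tailProb_nonneg p x) k)

theorem windowMean_le_one {a : ℕ} (p : PMF (Fin a)) (k : ℕ) : windowMean p k ≤ 1 := by
  rw [windowMean_eq, ← sum_letterProb p]
  exact Finset.sum_le_sum fun x _ => mul_le_of_le_one_right ENNReal.toReal_nonneg
    (pow_le_one₀ (tailProb_nonneg p x) (tailProb_le_one p x))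

theorem windowCov_zero_nonneg {a : ℕ} (p : PMF (Fin a)) (k : ℕ) : 0 ≤ windowCov p k 0 := by
  rw [windowCov, if_pos rfl]
  exact mul_nonneg (windowMean_nonneg p k) (sub_nonneg.2 (windowMean_le_one p k))

theorem fromTop_pos {a : ℕ} {p : PMF (Fin a)} (hp : ∀ i, 0 < p i) :
    ∀ i < a, 0 < fromTop (letterProb p) i := by
  intro i hi
  rw [fromTop, dif_pos hi]
  exact letterProb_pos hp _

theorem windowCov_of_mem {a : ℕ} (p : PMF (Fin a)) {k j : ℕ} (hj : j ∈ Finset.Icc 1 k) :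
    windowCov p k j = pairMass (fromTop (letterProb p)) k j a - windowMean p k ^ 2 := by
  rw [Finset.mem_Icc] at hj
  rw [windowCov, if_neg (by omega), if_pos hj.2]

/-- Negative correlations reduce the variance at most by the factor `2 * k + 1`. -/
theorem windowCov_zero_le {a : ℕ} {p : PMF (Fin a)} (hp : ∀ i, 0 < p i) (k : ℕ) :
    windowCov p k 0 ≤ (2 * k + 1) * asympVar p k := by
  have h := sum_cov_ge (k := k) (fromTop_pos hp) (mass_fromTop_self p)
  have h2 : ∑ j ∈ Finset.Icc 1 k, windowCov p k j =
      ∑ j ∈ Finset.Icc 1 k, (pairMass (fromTop (letterProb p)) k j a -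
        windowMass (fromTop (letterProb p)) k a ^ 2) :=
    Finset.sum_congr rfl fun j hj => windowCov_of_mem p hj
  have h3 : windowCov p k 0 = windowMass (fromTop (letterProb p)) k a *
      (1 - windowMass (fromTop (letterProb p)) k a) := by rw [windowCov, if_pos rfl, windowMean]
  rw [asympVar, h2]
  rw [← h3] at h
  have hD : (0 : ℝ) < 2 * k + 1 := by positivity
  have h4 := mul_le_mul_of_nonneg_left h hD.le
  have h5 : (2 * (k : ℝ) + 1) * -(k / (2 * k + 1) * windowCov p k 0) = -(k * windowCov p k 0) := by
    field_simp
  rw [h5] at h4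
  linarith

theorem neg_covMoment_le {a : ℕ} {p : PMF (Fin a)} (hp : ∀ i, 0 < p i) (k : ℕ) :
    -covMoment p k ≤ 3 / 8 * k * windowCov p k 0 := by
  have h3 : windowCov p k 0 = windowMass (fromTop (letterProb p)) k a *
      (1 - windowMass (fromTop (letterProb p)) k a) := by rw [windowCov, if_pos rfl, windowMean]
  have h := sum_mul_cov_ge (k := k) (fromTop_pos hp) (mass_fromTop_self p)
    (h3 ▸ windowCov_zero_nonneg p k)
  have h2 : covMoment p k =
      ∑ j ∈ Finset.Icc 1 k, (j : ℝ) * (pairMass (fromTop (letterProb p)) k j a -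
        windowMass (fromTop (letterProb p)) k a ^ 2) :=
    Finset.sum_congr rfl fun j hj => by rw [windowCov_of_mem p hj, windowMean]
  rw [h2, h3]
  linarith

theorem asympVar_nonneg {a : ℕ} {p : PMF (Fin a)} (hp : ∀ i, 0 < p i) (k : ℕ) :
    0 ≤ asympVar p k := by
  have h1 := windowCov_zero_nonneg p k
  have h2 := windowCov_zero_le hp k
  have hD : (0 : ℝ) < 2 * k + 1 := by positivity
  exact nonneg_of_mul_nonneg_right (h1.trans h2) hD

theorem asympVar_pos {a : ℕ} {p : PMF (Fin a)} (hp : ∀ i, 0 < p i) (ha : 2 ≤ a) {k : ℕ}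
    (hk : 1 ≤ k) : 0 < asympVar p k := by
  have hμ0 : 0 < windowMean p k := by
    rw [windowMean_eq]
    refine Finset.sum_pos (fun x _ => mul_pos (letterProb_pos hp x) (pow_pos ?_ k))
      ⟨⟨0, by omega⟩, Finset.mem_univ _⟩
    exact Finset.sum_pos (fun y _ => letterProb_pos hp y) ⟨x, Finset.mem_Ici.2 le_rfl⟩
  have hμ1 : windowMean p k < 1 := by
    rw [windowMean_eq, ← sum_letterProb p]
    refine Finset.sum_lt_sum (fun x _ => mul_le_of_le_one_right ENNReal.toReal_nonneg
      (pow_le_one₀ (tailProb_nonneg p x) (tailProb_le_one p x)))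
      ⟨⟨1, by omega⟩, Finset.mem_univ _, ?_⟩
    refine mul_lt_of_lt_one_right (letterProb_pos hp _)
      (pow_lt_one₀ (tailProb_nonneg p _) ?_ (by omega))
    rw [← sum_letterProb p]
    refine Finset.sum_lt_sum_of_subset (Finset.subset_univ _)
      (Finset.mem_univ (⟨0, by omega⟩ : Fin a)) ?_ (letterProb_pos hp _)
      fun _ _ _ => ENNReal.toReal_nonneg
    simp [Fin.le_def]
  have h1 : 0 < windowCov p k 0 := by
    rw [windowCov, if_pos rfl]
    exact mul_pos hμ0 (by linarith)
  have hD : (0 : ℝ) < 2 * k + 1 := by positivity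
  exact pos_of_mul_pos_right (h1.trans_le (windowCov_zero_le hp k)) hD.le

theorem integral_treeLaw {a : ℕ} (p : PMF (Fin a)) (n : ℕ)
    (g : Equiv.Perm (Fin (n - 1)) → ℝ) :
    ∫ γ, g γ ∂(treeLaw p n) = ∫ w, g (ranking w) ∂(wordLaw p (n - 1)) := by
  rw [treeLaw_eq_map, integral_map (measurable_of_finite _).aemeasurable
    (measurable_of_finite _).aestronglyMeasurable]

theorem numAtLeast_ranking_sub {a : ℕ} (p : PMF (Fin a)) (k n : ℕ) (w : Fin (n - 1) → Fin a) :
    (numAtLeast k (ranking w) : ℝ) - ∫ γ, (numAtLeast k γ : ℝ) ∂(treeLaw p n) =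
      ∑ s ∈ Finset.range (n - 1 - k), (minInd k s w - windowMean p k) := by
  rw [integral_treeLaw p n fun γ => (numAtLeast k γ : ℝ)]
  simp only [numAtLeast_ranks (ranks_ranking _)]
  rw [integral_add Integrable.of_finite Integrable.of_finite, integral_sum_fin,
    Finset.sum_congr rfl fun s hs => integral_minInd_eq p (Finset.mem_range.1 hs),
    Finset.sum_sub_distrib]
  simp

theorem varAtLeast_eq {a : ℕ} (p : PMF (Fin a)) (k n : ℕ) :
    varAtLeast p k n = ∫ w, (∑ s ∈ Finset.range (n - 1 - k),
      (minInd k s w - windowMean p k)) ^ 2 ∂(wordLaw p (n - 1)) := by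
  rw [varAtLeast, variance_eq_integral (measurable_of_finite _).aemeasurable,
    integral_treeLaw p n fun γ =>
      ((numAtLeast k γ : ℝ) - ∫ γ', (numAtLeast k γ' : ℝ) ∂(treeLaw p n)) ^ 2]
  simp only [numAtLeast_ranking_sub]

theorem varAtLeast_eq_asympVar {a : ℕ} (p : PMF (Fin a)) {k n : ℕ} (hn : k ≤ n - 1 - k) :
    varAtLeast p k n = ((n - 1 - k : ℕ) : ℝ) * asympVar p k - 2 * covMoment p k := by
  rw [varAtLeast_eq, ← integral_sq_window_block p (m := n - 1) (l := 0) hn (by omega)]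
  simp only [zero_add]

/-- Comparison with a block of length `k`, whose variance is nonnegative. -/
theorem two_mul_covMoment_le {a : ℕ} (p : PMF (Fin a)) (k : ℕ) :
    2 * covMoment p k ≤ k * asympVar p k := by
  have h := integral_sq_window_block p (m := 2 * k) (l := 0) (le_refl k) (by omega)
  have h2 : 0 ≤ ∫ w, (∑ i ∈ Finset.range k, (minInd k (0 + i) w - windowMean p k)) ^ 2
      ∂(wordLaw p (2 * k)) := integral_nonneg fun _ => sq_nonneg _
  linarith

theorem varAtLeast_le_sq {a : ℕ} (p : PMF (Fin a)) (k n : ℕ) :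
    varAtLeast p k n ≤ (((n - 1 - k : ℕ) : ℝ) / 2) ^ 2 := by
  have h := variance_le_sq_of_bounded (μ := wordLaw p (n - 1)) (a := 0) (b := (n - 1 - k : ℕ))
    (X := fun w => ∑ s ∈ Finset.range (n - 1 - k), minInd k s w)
    (ae_of_all _ fun w => ⟨Finset.sum_nonneg fun s _ => minInd_nonneg k s w, by
      refine (Finset.sum_le_sum fun s _ => minInd_le_one k s w).trans_eq ?_
      simp⟩) (measurable_of_finite _).aemeasurable
  rw [sub_zero] at h
  refine le_trans (le_of_eq ?_) h
  rw [varAtLeast_eq, variance_eq_integral (measurable_of_finite _).aemeasurable]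
  rw [integral_sum_fin, Finset.sum_congr rfl fun s hs => integral_minInd_eq p
    (Finset.mem_range.1 hs)]
  simp only [Finset.sum_sub_distrib]

/-! ### The Wasserstein bound -/

theorem wassersteinDist_treeLaw_le {a : ℕ} (p : PMF (Fin a)) (k n : ℕ) {c : ℝ}
    (hc : ∀ h : ℝ → ℝ, LipschitzWith 1 h →
      |(∫ w, h ((∑ s ∈ Finset.range (n - 1 - k), (minInd k s w - windowMean p k)) /
        sdAtLeast p k n) ∂(wordLaw p (n - 1))) - ∫ y, h y ∂(gaussianReal 0 1)| ≤ c) :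
    wassersteinDist ((treeLaw p n).map (normalized p k n)) (gaussianReal 0 1) ≤
      ENNReal.ofReal c := by
  refine iSup₂_le fun h hh => ENNReal.ofReal_le_ofReal ?_
  rw [integral_map (measurable_of_finite _).aemeasurable hh.continuous.aestronglyMeasurable,
    integral_treeLaw p n fun γ => h (normalized p k n γ)]
  simp only [normalized, numAtLeast_ranking_sub]
  exact hc h hh

theorem sq_sdAtLeast {a : ℕ} (p : PMF (Fin a)) (k n : ℕ) :
    sdAtLeast p k n ^ 2 = varAtLeast p k n := Real.sq_sqrt (variance_nonneg _ _)

/-- A standardized random variable is at distance at most `2` from the normal distribution. -/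
theorem abs_integral_sub_gaussian_le_two {Ω : Type*} [MeasurableSpace Ω] [Finite Ω]
    [MeasurableSingletonClass Ω] {P : Measure Ω} [IsProbabilityMeasure P] {W : Ω → ℝ}
    (hW : ∫ ω, W ω ^ 2 ∂P = 1) {h : ℝ → ℝ} (hh : LipschitzWith 1 h) :
    |(∫ ω, h (W ω) ∂P) - ∫ y, h y ∂(gaussianReal 0 1)| ≤ 2 := by
  have h1 : |(∫ ω, h (W ω) ∂P) - h 0| ≤ 1 := by
    have h2 : (∫ ω, h (W ω) ∂P) - h 0 = ∫ ω, (h (W ω) - h 0) ∂P := by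
      rw [integral_sub Integrable.of_finite Integrable.of_finite]
      simp
    rw [h2]
    refine abs_integral_le_integral_abs.trans (le_trans (b := ∫ ω, |W ω| ∂P)
      (integral_mono Integrable.of_finite Integrable.of_finite fun ω => ?_) ?_)
    · simpa using abs_sub_le_of_lipschitz hh (W ω) 0
    · have h3 := sq_integral_abs_le (P := P) W
      rw [hW] at h3
      exact (le_abs_self _).trans ((sq_le_one_iff_abs_le_one _).1 h3)
  have h2 : |h 0 - ∫ y, h y ∂(gaussianReal 0 1)| ≤ 1 := by
    obtain ⟨a, b, ha, hb, hab, -⟩ := steinSol_decomp hh 0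
    have := gaussDensity_le 0
    rw [hab, abs_neg]
    refine (abs_add_le a b).trans ?_
    linarith
  calc _ = |((∫ ω, h (W ω) ∂P) - h 0) + (h 0 - ∫ y, h y ∂(gaussianReal 0 1))| := by ring_nf
    _ ≤ _ := (abs_add_le _ _).trans (by linarith)

theorem nbhd_eq_Ico (k N i : ℕ) : nbhd k N i = Finset.Ico (i - k) (min N (i + k + 1)) := by
  ext j
  simp only [nbhd, Finset.mem_filter, Finset.mem_range, Finset.mem_Ico, lt_min_iff]
  omega

/-- Windows around an index contain at most `2 * k + 1` terms, so their variance is at most that of a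
full window. -/
theorem integral_sq_nbhd_le {a : ℕ} {p : PMF (Fin a)} (hp : ∀ i, 0 < p i) {m k i : ℕ}
    (hN : 3 * k ≤ m - k) (hi : i < m - k) :
    ∫ w, (∑ j ∈ nbhd k (m - k) i, (minInd k j w - windowMean p k)) ^ 2 ∂(wordLaw p m) ≤
      (2 * k + 1) * asympVar p k - 2 * covMoment p k := by
  simp only [nbhd_eq_Ico, Finset.sum_Ico_eq_sum_range]
  rw [integral_sq_window_block p (by omega) (by omega)]
  have h1 : ((min (m - k) (i + k + 1) - (i - k) : ℕ) : ℝ) ≤ 2 * k + 1 := by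
    have : min (m - k) (i + k + 1) - (i - k) ≤ 2 * k + 1 := by omega
    exact_mod_cast this
  have := mul_le_mul_of_nonneg_right h1 (asympVar_nonneg hp k)
  linarith

/-- The comparison of the window variances with the total variance that turns the estimate for sums
of `k`-dependent variables into a bound in terms of the total variance alone. -/
theorem card_mul_window_var_le {a : ℕ} {p : PMF (Fin a)} (hp : ∀ i, 0 < p i) {k n : ℕ}
    (hk : 1 ≤ k) (hN : 3 * k ≤ n - 1 - k) :
    ((n - 1 - k : ℕ) : ℝ) * ((2 * k + 1) * asympVar p k - 2 * covMoment p k) ≤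
      (2 * k + 1) ^ 2 * varAtLeast p k n := by
  rw [varAtLeast_eq_asympVar p (by omega)]
  have h1 := two_mul_covMoment_le p k
  have h2 := neg_covMoment_le hp k
  have h3 := windowCov_zero_le hp k
  have h4 := asympVar_nonneg hp k
  have hN' : 3 * (k : ℝ) ≤ ((n - 1 - k : ℕ) : ℝ) := by exact_mod_cast hN
  have hk' : (1 : ℝ) ≤ k := by exact_mod_cast hk
  generalize ((n - 1 - k : ℕ) : ℝ) = N at *
  generalize asympVar p k = v at *
  generalize covMoment p k = K at *
  generalize windowCov p k 0 = g at *
  generalize (k : ℝ) = x at *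
  -- The window variance is at most `(2x+1) v (1 + 3x/4)`, and the total at least `2/3 * N v`.
  have h5 : (2 * x + 1) * v - 2 * K ≤ (2 * x + 1) * v * (1 + 3 / 4 * x) := by nlinarith
  have h6 : 2 / 3 * N * v ≤ N * v - 2 * K := by nlinarith
  have h7 : N * ((2 * x + 1) * v - 2 * K) ≤ N * ((2 * x + 1) * v * (1 + 3 / 4 * x)) :=
    mul_le_mul_of_nonneg_left h5 (by linarith)
  have h8 : (2 * x + 1) ^ 2 * (2 / 3 * N * v) ≤ (2 * x + 1) ^ 2 * (N * v - 2 * K) :=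
    mul_le_mul_of_nonneg_left h6 (by positivity)
  have h9 : 0 ≤ N * v * (2 * x + 1) := mul_nonneg (mul_nonneg (by linarith) h4) (by linarith)
  nlinarith

theorem sqrt_const_le : 3 / 2 * Real.sqrt 3 ≤ Real.sqrt 28 / Real.sqrt Real.pi := by
  rw [← Real.sqrt_div (by norm_num)]
  refine Real.le_sqrt_of_sq_le ?_
  rw [mul_pow, Real.sq_sqrt (by norm_num), le_div_iff₀ Real.pi_pos]
  nlinarith [Real.pi_lt_d2]

theorem stein_bound_le_cltBound {k : ℕ} {σ A : ℝ} (hσ : 0 < σ)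
    (hA : A ≤ (2 * k + 1) ^ 2 * σ ^ 2) :
    A / σ ^ 3 + 3 / 2 * (Real.sqrt ((6 * k + 1) * A) / σ ^ 2) ≤ cltBound k σ := by
  set D : ℝ := 2 * k + 1 with hD
  have hD0 : 0 < D := by positivity
  have h1 : A / σ ^ 3 ≤ D ^ 2 / σ := by
    rw [div_le_div_iff₀ (by positivity) hσ]
    calc A * σ ≤ D ^ 2 * σ ^ 2 * σ := mul_le_mul_of_nonneg_right hA hσ.le
      _ = _ := by ring
  have h2 : Real.sqrt ((6 * k + 1) * A) ≤ Real.sqrt 3 * Real.sqrt D * D * σ := by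
    have h3 : (6 * (k : ℝ) + 1) * A ≤ 3 * D * (D * σ) ^ 2 := by
      have h4 := mul_le_mul_of_nonneg_left hA (show (0 : ℝ) ≤ 6 * k + 1 by positivity)
      have h5 : (6 * (k : ℝ) + 1) * (D ^ 2 * σ ^ 2) ≤ 3 * D * (D ^ 2 * σ ^ 2) :=
        mul_le_mul_of_nonneg_right (by rw [hD]; linarith) (by positivity)
      linarith
    refine (Real.sqrt_le_sqrt h3).trans_eq ?_
    rw [Real.sqrt_mul (by positivity), Real.sqrt_sq (by positivity), Real.sqrt_mul (by norm_num)]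
    ring
  have h3 : 3 / 2 * (Real.sqrt ((6 * k + 1) * A) / σ ^ 2) ≤
      3 / 2 * Real.sqrt 3 * (Real.sqrt D * D / σ) := by
    calc _ ≤ 3 / 2 * (Real.sqrt 3 * Real.sqrt D * D * σ / σ ^ 2) := by gcongr
      _ = _ := by field_simp
  have h4 : 3 / 2 * Real.sqrt 3 * (Real.sqrt D * D / σ) ≤
      Real.sqrt 28 / Real.sqrt Real.pi * (Real.sqrt D * D / σ) :=
    mul_le_mul_of_nonneg_right sqrt_const_le (by positivity)
  have h5 : cltBound k σ = D ^ 2 / σ +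
      Real.sqrt 28 / Real.sqrt Real.pi * (Real.sqrt D * D / σ) := by
    rw [cltBound, ← hD]
    ring
  rw [h5]
  linarith

theorem varAtLeast_zero {a : ℕ} (p : PMF (Fin a)) (n : ℕ) : varAtLeast p 0 n = 0 := by
  rw [varAtLeast_eq_asympVar p (Nat.zero_le _), asympVar, covMoment, windowCov, if_pos rfl,
    windowMean_eq]
  simp [sum_letterProb]

theorem wassersteinDist_le_cltBound {a : ℕ} {p : PMF (Fin a)} (hp : ∀ i, 0 < p i) (k n : ℕ)
    (hσ : 0 < sdAtLeast p k n) :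
    wassersteinDist ((treeLaw p n).map (normalized p k n)) (gaussianReal 0 1) ≤
      ENNReal.ofReal (cltBound k (sdAtLeast p k n)) := by
  have hk : 1 ≤ k := by
    by_contra h
    obtain rfl : k = 0 := by omega
    rw [sdAtLeast, varAtLeast_zero, Real.sqrt_zero] at hσ
    exact lt_irrefl _ hσ
  have hk' : (1 : ℝ) ≤ k := by exact_mod_cast hk
  have hσ2 := sq_sdAtLeast p k n
  refine wassersteinDist_treeLaw_le p k n fun h hh => ?_
  rcases le_or_gt (3 * k) (n - 1 - k) with hN | hN
  · have hle := KDependent.abs_integral_sub_le (N := n - 1 - k)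
      (kDependent_minInd p (n - 1) k (windowMean p k))
      (fun i hi => integral_minInd_sub p hi)
      (fun i w => by
        have h1 := minInd_nonneg k i w
        have h2 := minInd_le_one k i w
        have h3 := windowMean_nonneg p k
        have h4 := windowMean_le_one p k
        rw [abs_le]; constructor <;> linarith)
      (B := (2 * k + 1) * asympVar p k - 2 * covMoment p k)
      (fun i hi => integral_sq_nbhd_le hp hN hi)
      (by
        have h1 := two_mul_covMoment_le p k
        have h2 := mul_nonneg (by linarith : (0 : ℝ) ≤ k + 1) (asympVar_nonneg hp k)
        linarith)
      hσ (by rw [hσ2, varAtLeast_eq]) hh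
    refine hle.trans ?_
    rw [mul_assoc (6 * (k : ℝ) + 1)]
    refine stein_bound_le_cltBound hσ ?_
    rw [hσ2]
    exact card_mul_window_var_le hp hk hN
  · -- For short decks the right-hand side is at least `2`.
    have h1 : sdAtLeast p k n ≤ 3 / 2 * k := by
      refine Real.sqrt_le_iff.2 ⟨by positivity, (varAtLeast_le_sq p k n).trans ?_⟩
      have h2 : ((n - 1 - k : ℕ) : ℝ) ≤ 3 * k := by exact_mod_cast hN.le
      exact pow_le_pow_left₀ (by positivity) (by linarith) 2
    have h2 : 2 ≤ cltBound k (sdAtLeast p k n) := by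
      have h3 : (2 * (k : ℝ) + 1) / sdAtLeast p k n * (2 * k + 1) ≤
          cltBound k (sdAtLeast p k n) := by
        refine mul_le_mul_of_nonneg_left ?_ (by positivity)
        have : 0 ≤ Real.sqrt 28 * Real.sqrt (2 * (k : ℝ) + 1) / Real.sqrt Real.pi := by positivity
        linarith
      refine le_trans ?_ h3
      rw [div_mul_eq_mul_div, le_div_iff₀ hσ]
      nlinarith
    refine le_trans (abs_integral_sub_gaussian_le_two ?_ hh) h2
    simp only [div_pow]
    rw [integral_div, ← varAtLeast_eq, ← hσ2, div_self (pow_ne_zero 2 hσ.ne')]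

/-! ### The order of the variance -/

theorem eventually_le_varAtLeast {a : ℕ} {p : PMF (Fin a)} (hp : ∀ i, 0 < p i) (k : ℕ) :
    ∀ᶠ n : ℕ in atTop, asympVar p k / 2 * n ≤ varAtLeast p k n := by
  filter_upwards [eventually_ge_atTop (4 * k + 2)] with n hn
  rw [varAtLeast_eq_asympVar p (by omega)]
  have h1 := two_mul_covMoment_le p k
  have h2 := asympVar_nonneg hp k
  have h3 : ((n - 1 - k : ℕ) : ℝ) = n - 1 - k := by
    rw [Nat.cast_sub (by omega), Nat.cast_sub (by omega)]; simp
  have h4 : 4 * (k : ℝ) + 2 ≤ n := by exact_mod_cast hn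
  rw [h3]
  nlinarith

theorem varAtLeast_isTheta {a : ℕ} {p : PMF (Fin a)} (hp : ∀ i, 0 < p i) (ha : 2 ≤ a) {k : ℕ}
    (hk : 1 ≤ k) : (fun n : ℕ => varAtLeast p k n) =Θ[atTop] fun n : ℕ => (n : ℝ) := by
  have hv := asympVar_pos hp ha hk
  constructor
  · refine IsBigO.of_bound (asympVar p k + 2 * |covMoment p k|) ?_
    filter_upwards [eventually_ge_atTop (2 * k + 1)] with n hn
    have h0 : 0 ≤ varAtLeast p k n := variance_nonneg _ _
    rw [Real.norm_of_nonneg h0, Real.norm_natCast, varAtLeast_eq_asympVar p (by omega)]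
    have h1 : ((n - 1 - k : ℕ) : ℝ) ≤ n := by exact_mod_cast (by omega : n - 1 - k ≤ n)
    have h2 : (1 : ℝ) ≤ n := by exact_mod_cast (by omega : 1 ≤ n)
    have h3 := neg_abs_le (covMoment p k)
    have h4 := mul_le_mul_of_nonneg_right h1 hv.le
    have h5 := mul_le_mul_of_nonneg_left h2 (abs_nonneg (covMoment p k))
    linarith
  · refine IsBigO.of_bound (2 / asympVar p k) ?_
    filter_upwards [eventually_le_varAtLeast hp k] with n hn
    have h0 : 0 ≤ varAtLeast p k n := variance_nonneg _ _
    rw [Real.norm_of_nonneg h0, Real.norm_natCast, div_mul_eq_mul_div, le_div_iff₀ hv]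
    linarith

theorem cltBound_isBigO {a : ℕ} {p : PMF (Fin a)} (hp : ∀ i, 0 < p i) (ha : 2 ≤ a) {k : ℕ}
    (hk : 1 ≤ k) : (fun n : ℕ => cltBound k (sdAtLeast p k n)) =O[atTop]
      fun n : ℕ => (n : ℝ) ^ (-(1 / 2) : ℝ) := by
  have hv := asympVar_pos hp ha hk
  set C : ℝ := (2 * (k : ℝ) + 1) * ((2 * (k : ℝ) + 1) +
    Real.sqrt 28 * Real.sqrt (2 * (k : ℝ) + 1) / Real.sqrt Real.pi) with hC
  have hC0 : 0 ≤ C := by positivity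
  refine IsBigO.of_bound (C / Real.sqrt (asympVar p k / 2)) ?_
  filter_upwards [eventually_le_varAtLeast hp k, eventually_ge_atTop 1] with n hn hn1
  have hn0 : (0 : ℝ) < n := by exact_mod_cast hn1
  have h1 : Real.sqrt (asympVar p k / 2) * Real.sqrt n ≤ sdAtLeast p k n := by
    rw [← Real.sqrt_mul (by positivity)]
    exact Real.sqrt_le_sqrt hn
  have h2 : 0 < Real.sqrt (asympVar p k / 2) * Real.sqrt n :=
    mul_pos (Real.sqrt_pos.2 (by positivity)) (Real.sqrt_pos.2 hn0)
  have h3 : cltBound k (sdAtLeast p k n) = C / sdAtLeast p k n := by rw [cltBound, hC]; ring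
  have h4 : (n : ℝ) ^ (-(1 / 2) : ℝ) = (Real.sqrt n)⁻¹ := by
    rw [Real.rpow_neg hn0.le, Real.sqrt_eq_rpow]
  rw [h3, h4, Real.norm_of_nonneg (div_nonneg hC0 (h2.le.trans h1)),
    Real.norm_of_nonneg (by positivity)]
  refine (div_le_div_of_nonneg_left hC0 h2 h1).trans_eq ?_
  rw [← div_eq_mul_inv, div_div]

end BRT

theorem theorem4p3 {a : ℕ} (p : PMF (Fin a)) (hp : ∀ i, 0 < p i) (k : ℕ) :
    (∀ n : ℕ, 1 ≤ n → 0 < BRT.sdAtLeast p k n →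
      BRT.wassersteinDist ((BRT.treeLaw p n).map (BRT.normalized p k n)) (gaussianReal 0 1) ≤
        ENNReal.ofReal (BRT.cltBound k (BRT.sdAtLeast p k n))) ∧
    (2 ≤ a → 1 ≤ k →
      (fun n : ℕ => BRT.varAtLeast p k n) =Θ[atTop] (fun n : ℕ => (n : ℝ)) ∧
      (fun n : ℕ => BRT.cltBound k (BRT.sdAtLeast p k n)) =O[atTop]
        (fun n : ℕ => (n : ℝ) ^ (-(1 / 2) : ℝ))) :=
  ⟨fun n _ hσ => BRT.wassersteinDist_le_cltBound hp k n hσ,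
    fun ha hk => ⟨BRT.varAtLeast_isTheta hp ha hk, BRT.cltBound_isBigO hp ha hk⟩⟩
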